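/- Let $\mathcal T$ be a tiling of the Euclidean plane, i.e. a family of sets (cells) that cover the plane and have pairwise disjoint interiors. Assume that $\mathcal T$ is normal: every cell is homeomorphic to a closed disk, the intersection of any two distinct cells is connected or empty, and the cells are uniformly bounded (there are $r,R>0$ such that every cell contains a disk of radius $r$ and is contained in a disk of radius $R$). Assume that $\mathcal T$ is monohedral: any two cells are congruent by an isometry of the plane, possibly orientation-reversing. Let $C$ be a cell whose boundary is piecewise $C^2$: it is a simple closed curve made up of $v\ge 1$ cyclically consecutive arcs $e_1,\dots,e_v$, each parametrized by $[0,1]$ with non-vanishing velocity, continuously differentiable on $[0,1]$ and twice continuously differentiable on $(0,1)$, such that $e_k$ ends where $e_{k+1}$ starts (with $e_{v+1}=e_1$). Let the corner degree $v^{\star}$ of $C$ be the number of indices $k\in\{1,\dots,v\}$ such that $e_k$ and $e_{k+1}$ do not meet at $180^\circ$ at their common endpoint, i.e. such that the angle between their half-tangents there (each pointing into its arc) is not $\pi$. Then $v^{\star}\ge 2$. -/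

import Mathlib

open Set

/-- The Euclidean plane. -/
abbrev Plane : Type := EuclideanSpace ℝ (Fin 2)

/-- A family of cells `T i` is a normal tiling of the Euclidean plane: the cells cover the plane
without overlapping, every cell is a closed topological disk, the intersection of any two cells is
connected or empty, and the cells are uniformly bounded (from inside and from outside). -/
structure IsNormalTiling {ι : Type*} (T : ι → Set Plane) : Prop where
  cover : ⋃ i, T i = univ
  nonoverlapping : ∀ i j, i ≠ j → Disjoint (interior (T i)) (interior (T j))
  disk : ∀ i, Nonempty (T i ≃ₜ Metric.closedBall (0 : Plane) 1)
  inter_connected : ∀ i j, i ≠ j → IsPreconnected (T i ∩ T j)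
  uniformly_bounded : ∃ r R : ℝ, 0 < r ∧
    ∀ i, (∃ c, Metric.closedBall c r ⊆ T i) ∧ (∃ c, T i ⊆ Metric.closedBall c R)

/-- All cells are congruent (orientation-reversing congruences are allowed). -/
def IsMonohedral {ι : Type*} (T : ι → Set Plane) : Prop :=
  ∀ i j, ∃ f : Plane ≃ᵢ Plane, f '' T i = T j

/-- A parametrized arc that has half-tangents at both endpoints and is twice continuously
differentiable, with non-zero velocity: `C¹` on `[0, 1]` and `C²` on `(0, 1)`. Arcs that are `C²`
up to their endpoints are included. -/
structure IsC2Arc (γ : ℝ → Plane) : Prop where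
  contDiff_one : ContDiffOn ℝ 1 γ (Icc 0 1)
  contDiff_two : ContDiffOn ℝ 2 γ (Ioo 0 1)
  velocity_ne_zero : ∀ t ∈ Icc (0 : ℝ) 1, derivWithin γ (Icc 0 1) t ≠ 0

/-- The boundary of the cell `C` is the simple closed curve that is made up of the `v ≥ 1` arcs
`e 0, …, e (v - 1)`, cyclically numbered (addition in `Fin v` is modulo `v`), where each arc is
twice continuously differentiable and ends where the next one starts. -/
structure IsC2Boundary (C : Set Plane) {v : ℕ} [NeZero v] (e : Fin v → ℝ → Plane) : Prop where
  arc : ∀ k, IsC2Arc (e k)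
  consecutive : ∀ k, e k 1 = e (k + 1) 0
  simple : ∀ k l, ∀ s ∈ Ico (0 : ℝ) 1, ∀ t ∈ Ico (0 : ℝ) 1, e k s = e l t → k = l ∧ s = t
  image : ⋃ k, e k '' Icc 0 1 = frontier C

/-- The half-tangent of an arc at its initial point, pointing into the arc. -/
noncomputable def startHalfTangent (γ : ℝ → Plane) : Plane :=
  derivWithin γ (Icc 0 1) 0

/-- The half-tangent of an arc at its final point, pointing back into the arc. -/
noncomputable def endHalfTangent (γ : ℝ → Plane) : Plane :=
  -derivWithin γ (Icc 0 1) 1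

/-- The pair of consecutive arcs `e k`, `e (k + 1)` is degenerate: at their common vertex they meet
at 180 degrees, that is, the boundary has no corner there. -/
def IsDegeneratePair {v : ℕ} [NeZero v] (e : Fin v → ℝ → Plane) (k : Fin v) : Prop :=
  InnerProductGeometry.angle (endHalfTangent (e k)) (startHalfTangent (e (k + 1))) = Real.pi

/-- The corner degree: the number of generic (that is, not degenerate) pairs of consecutive arcs. -/
noncomputable def cornerDegree {v : ℕ} [NeZero v] (e : Fin v → ℝ → Plane) : ℕ :=
  {k : Fin v | ¬ IsDegeneratePair e k}.ncard

/-! Suppose some cell has at most one corner. By congruence every cell `T i` then carries one marked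
boundary point `c i` (its corner, or some vertex), and at every other boundary point its interior
contains, to first order, an open half-plane of directions (`HasInnerHalfplane`). Three open
half-planes of directions cannot be pairwise disjoint, so a point of three cells is marked by one of
them. Call the marked points nodes; at each node at most two cells have their own mark elsewhere.

On the other hand every cell has at least three nodes (`three_le_ncard_nodes`). With fewer, its
boundary would be covered by two other cells. Since intersections of cells are connected, two or
three cells would then enclose each other completely, which `not_closed_family` excludes: their
union would be bounded with nonempty interior, but have finite frontier.

Now count the pairs of a cell and a node on it other than its own mark. Each cell contributes at
least two pairs, each node at most two, and there are no more nodes than cells. So inside a large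
disk the count is tight up to a boundary layer, and a cell with four nodes, or with a mark shared by
another cell, produces an excess. Every cell meets such a cell (`exists_excess`): otherwise it and
its three neighbors would form a tetrahedron, again a closed family. The excess is thus a fixed
proportion of all cells, and the number of cells that meet a disk grows exponentially with the
radius (`not_isOneCornerTiling`), whereas comparing areas bounds it quadratically. -/

open Filter Topology
open scoped RealInnerProductSpace

/-! ### Simple loops and their arcs -/

/-- A simple loop: the image of a continuous `1`-periodic map that is injective modulo `1`. -/
structure IsLoopParam {X : Type*} [TopologicalSpace X] (J : Set X) (γ : ℝ → X) : Prop where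
  continuous : Continuous γ
  eq_iff : ∀ s t, γ s = γ t ↔ ∃ n : ℤ, t = s + n
  range_eq : range γ = J

/-- A simple loop (Jordan curve) in a topological space. -/
def IsSimpleLoop {X : Type*} [TopologicalSpace X] (J : Set X) : Prop :=
  ∃ γ : ℝ → X, IsLoopParam J γ

namespace IsLoopParam

variable {X : Type*} [TopologicalSpace X] {J : Set X} {γ : ℝ → X}

theorem mem (h : IsLoopParam J γ) (t : ℝ) : γ t ∈ J := h.range_eq ▸ mem_range_self t

theorem eq_one_zero (h : IsLoopParam J γ) : γ 1 = γ 0 :=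
  ((h.eq_iff 0 1).2 ⟨1, by norm_num⟩).symm

theorem add_int (h : IsLoopParam J γ) (t : ℝ) (n : ℤ) : γ (t + n) = γ t :=
  ((h.eq_iff t (t + n)).2 ⟨n, rfl⟩).symm

theorem shift (h : IsLoopParam J γ) (a : ℝ) : IsLoopParam J (fun t => γ (a + t)) where
  continuous := h.continuous.comp (by fun_prop)
  eq_iff s t := by
    rw [h.eq_iff]
    exact exists_congr fun n => ⟨fun h => by linarith, fun h => by linarith⟩
  range_eq := by
    rw [← h.range_eq]
    ext x
    constructor
    · rintro ⟨t, rfl⟩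
      exact ⟨_, rfl⟩
    · rintro ⟨t, rfl⟩
      exact ⟨t - a, by simp⟩

theorem reverse (h : IsLoopParam J γ) : IsLoopParam J (fun t => γ (-t)) where
  continuous := h.continuous.comp (by fun_prop)
  eq_iff s t := by
    rw [h.eq_iff]
    constructor
    · rintro ⟨n, hn⟩
      exact ⟨-n, by push_cast; linarith⟩
    · rintro ⟨n, hn⟩
      exact ⟨-n, by push_cast; linarith⟩
  range_eq := by
    rw [← h.range_eq]
    ext x
    constructor
    · rintro ⟨t, rfl⟩
      exact ⟨_, rfl⟩
    · rintro ⟨t, rfl⟩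
      exact ⟨-t, by simp⟩

theorem exists_Ico (h : IsLoopParam J γ) (a : ℝ) {x : X} (hx : x ∈ J) :
    ∃ t ∈ Ico a (a + 1), γ t = x := by
  rw [← h.range_eq] at hx
  obtain ⟨t, rfl⟩ := hx
  refine ⟨t - ⌊t - a⌋, ⟨?_, ?_⟩, ?_⟩
  · linarith [Int.floor_le (t - a)]
  · linarith [Int.lt_floor_add_one (t - a)]
  · have := h.add_int t (-⌊t - a⌋)
    rw [← this]
    congr 1
    push_cast
    ring

theorem injOn (h : IsLoopParam J γ) {a s t : ℝ} (hs : s ∈ Ico a (a + 1)) (ht : t ∈ Ico a (a + 1))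
    (hst : γ s = γ t) : s = t := by
  obtain ⟨n, hn⟩ := (h.eq_iff s t).1 hst
  have h1 : (n : ℝ) < 1 := by linarith [hs.1, ht.2]
  have h2 : (-1 : ℝ) < n := by linarith [hs.2, ht.1]
  have h1' : n < 1 := by exact_mod_cast h1
  have h2' : -1 < n := by exact_mod_cast h2
  have : n = 0 := by omega
  simp [this] at hn
  exact hn.symm

theorem image_Icc (h : IsLoopParam J γ) : γ '' Icc 0 1 = J := by
  apply Subset.antisymm
  · rintro _ ⟨t, -, rfl⟩
    exact h.mem t
  · intro x hx
    obtain ⟨t, ht, rfl⟩ := h.exists_Ico 0 hx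
    exact ⟨t, ⟨ht.1, by linarith [ht.2]⟩, rfl⟩

theorem diff_singleton (h : IsLoopParam J γ) : J \ {γ 0} = γ '' Ioo 0 1 := by
  apply Subset.antisymm
  · rintro x ⟨hx, hx0⟩
    obtain ⟨t, ht, rfl⟩ := h.exists_Ico 0 hx
    refine ⟨t, ⟨lt_of_le_of_ne ht.1 ?_, by linarith [ht.2]⟩, rfl⟩
    rintro rfl
    exact hx0 rfl
  · rintro _ ⟨t, ht, rfl⟩
    refine ⟨h.mem t, fun h0 => ?_⟩
    have := h.injOn (a := 0) (s := t) (t := 0) ⟨ht.1.le, by linarith [ht.2]⟩ (by simp) h0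
    exact ht.1.ne' this

theorem image_Ioo_infinite (h : IsLoopParam J γ) {a b : ℝ} (ha : 0 ≤ a) (hab : a < b)
    (hb : b ≤ 1) : (γ '' Ioo a b).Infinite := by
  refine (Ioo_infinite hab).image fun s hs t ht => h.injOn (a := 0) ?_ ?_
  · exact ⟨by linarith [hs.1], by linarith [hs.2]⟩
  · exact ⟨by linarith [ht.1], by linarith [ht.2]⟩

theorem image_Icc_subset_of_isClosed (h : IsLoopParam J γ) {a b : ℝ} (hab : a < b) {K : Set X}
    (hK : IsClosed K) (hsub : γ '' Ioo a b ⊆ K) : γ '' Icc a b ⊆ K := by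
  rw [image_subset_iff] at *
  rw [← closure_Ioo hab.ne]
  exact (hK.preimage h.continuous).closure_subset_iff.2 hsub

theorem isPreconnected_image_Ioo (h : IsLoopParam J γ) (a b : ℝ) :
    IsPreconnected (γ '' Ioo a b) :=
  isPreconnected_Ioo.image _ h.continuous.continuousOn

/-- A preconnected subset of a simple loop that contains two points of the loop contains one of
the two arcs between them. -/
theorem arc_subset [T2Space X] (h : IsLoopParam J γ) {s : ℝ} (hs : s ∈ Ioo (0 : ℝ) 1)
    {S : Set X} (hSJ : S ⊆ J) (hS : IsPreconnected S) (h0 : γ 0 ∈ S) (h1 : γ s ∈ S) :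
    γ '' Icc 0 s ⊆ S ∨ γ '' Icc s 1 ⊆ S := by
  by_contra! hcon
  obtain ⟨ha, hb⟩ := hcon
  obtain ⟨_, ⟨a, ha, rfl⟩, haS⟩ := not_subset.1 ha
  obtain ⟨_, ⟨b, hb, rfl⟩, hbS⟩ := not_subset.1 hb
  have ha0 : 0 < a := lt_of_le_of_ne ha.1 (by rintro rfl; exact haS h0)
  have has : a < s := lt_of_le_of_ne ha.2 (by rintro rfl; exact haS h1)
  have hsb : s < b := lt_of_le_of_ne hb.1 (by rintro rfl; exact hbS h1)
  have hb1 : b < 1 := lt_of_le_of_ne hb.2 (by rintro rfl; exact hbS (h.eq_one_zero ▸ h0))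
  -- The missed points `γ a` and `γ b` cut the loop into two closed arcs, one through `γ s` and one
  -- through `γ 0 = γ 1`. A connected `S` meeting both would contain a cut point.
  have hc1 : IsClosed (γ '' Icc a b) := (isCompact_Icc.image h.continuous).isClosed
  have hc2 : IsClosed (γ '' Icc b (a + 1)) := (isCompact_Icc.image h.continuous).isClosed
  have hcov : S ⊆ γ '' Icc a b ∪ γ '' Icc b (a + 1) := by
    intro x hx
    obtain ⟨t, ht, rfl⟩ := h.exists_Ico a (hSJ hx)
    rcases le_total t b with htb | htb
    · exact Or.inl ⟨t, ⟨ht.1, htb⟩, rfl⟩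
    · exact Or.inr ⟨t, ⟨htb, ht.2.le⟩, rfl⟩
  obtain ⟨x, hxS, ⟨t, ht, rfl⟩, ⟨t', ht', htt'⟩⟩ := isPreconnected_closed_iff.1 hS _ _ hc1 hc2 hcov
    ⟨_, h1, s, ⟨has.le, hsb.le⟩, rfl⟩
    ⟨_, h0, 1, ⟨hb1.le, by linarith⟩, h.eq_one_zero⟩
  rcases eq_or_lt_of_le ht'.2 with h' | h'
  · apply haS
    have : γ t' = γ a := by rw [h']; exact_mod_cast h.add_int a 1
    rwa [← this, htt']
  · have := h.injOn (a := a) ⟨by linarith [ht'.1], h'⟩ ⟨ht.1, by linarith [ht.2]⟩ htt'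
    have hbt : t = b := by linarith [ht'.1, ht.2]
    exact hbS (hbt ▸ hxS)

end IsLoopParam

namespace IsSimpleLoop

variable {X : Type*} [TopologicalSpace X] {J : Set X}

theorem exists_param (h : IsSimpleLoop J) {p : X} (hp : p ∈ J) :
    ∃ γ, IsLoopParam J γ ∧ γ 0 = p := by
  obtain ⟨γ, hγ⟩ := h
  obtain ⟨t, -, rfl⟩ := hγ.exists_Ico 0 hp
  exact ⟨_, hγ.shift t, by simp⟩

theorem exists_param₂ (h : IsSimpleLoop J) {p q : X} (hp : p ∈ J) (hq : q ∈ J) (hpq : p ≠ q) :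
    ∃ γ, IsLoopParam J γ ∧ γ 0 = p ∧ ∃ s ∈ Ioo (0 : ℝ) 1, γ s = q := by
  obtain ⟨γ, hγ, rfl⟩ := h.exists_param hp
  have : q ∈ J \ {γ 0} := ⟨hq, fun h => hpq h.symm⟩
  rw [hγ.diff_singleton] at this
  obtain ⟨s, hs, rfl⟩ := this
  exact ⟨γ, hγ, rfl, s, hs, rfl⟩

theorem exists_param_arc_subset [T2Space X] (h : IsSimpleLoop J) {p q : X} (hpq : p ≠ q)
    {S : Set X} (hSJ : S ⊆ J) (hS : IsPreconnected S) (hp : p ∈ S) (hq : q ∈ S) :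
    ∃ γ, IsLoopParam J γ ∧ γ 0 = p ∧ ∃ s ∈ Ioo (0 : ℝ) 1, γ s = q ∧ γ '' Icc s 1 ⊆ S := by
  obtain ⟨γ, hγ, rfl, s, hs, rfl⟩ := h.exists_param₂ (hSJ hp) (hSJ hq) hpq
  rcases hγ.arc_subset hs hSJ hS hp hq with h1 | h1
  · refine ⟨_, hγ.reverse, by simp, 1 - s, ⟨by linarith [hs.2], by linarith [hs.1]⟩, ?_, ?_⟩
    · have := hγ.add_int s (-1)
      rw [← this]
      congr 1
      push_cast
      ring
    · rintro _ ⟨t, ht, rfl⟩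
      apply h1
      refine ⟨1 - t, ⟨by linarith [ht.2], by linarith [ht.1]⟩, ?_⟩
      have := hγ.add_int (-t) 1
      refine Eq.trans ?_ this
      congr 1
      push_cast
      ring
  · exact ⟨γ, hγ, rfl, s, hs, rfl, h1⟩

theorem infinite (h : IsSimpleLoop J) : J.Infinite := by
  obtain ⟨γ, hγ⟩ := h
  refine (hγ.image_Ioo_infinite (a := 0) (b := 1) le_rfl one_pos le_rfl).mono ?_
  rintro _ ⟨t, -, rfl⟩
  exact hγ.mem t

theorem nonempty (h : IsSimpleLoop J) : J.Nonempty := h.infinite.nonempty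

theorem exists_ne (h : IsSimpleLoop J) (p : X) : ∃ q ∈ J, q ≠ p := by
  by_contra! hcon
  exact h.infinite ((finite_singleton p).subset fun q hq => hcon q hq)

theorem isPreconnected (h : IsSimpleLoop J) : IsPreconnected J := by
  obtain ⟨γ, hγ⟩ := h
  exact hγ.image_Icc ▸ isPreconnected_Icc.image _ hγ.continuous.continuousOn

theorem isPreconnected_diff_singleton (h : IsSimpleLoop J) {p : X} (hp : p ∈ J) :
    IsPreconnected (J \ {p}) := by
  obtain ⟨γ, hγ, rfl⟩ := h.exists_param hp
  exact hγ.diff_singleton ▸ hγ.isPreconnected_image_Ioo 0 1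

theorem subset_of_diff_singleton_subset (h : IsSimpleLoop J) {p : X} (hp : p ∈ J) {K : Set X}
    (hK : IsClosed K) (hsub : J \ {p} ⊆ K) : J ⊆ K := by
  obtain ⟨γ, hγ, rfl⟩ := h.exists_param hp
  rw [hγ.diff_singleton] at hsub
  exact hγ.image_Icc ▸ hγ.image_Icc_subset_of_isClosed one_pos hK hsub

/-- A simple loop contains no other simple loop. -/
theorem eq_of_subset [T2Space X] {J' : Set X} (h : IsSimpleLoop J) (h' : IsSimpleLoop J')
    (hsub : J ⊆ J') : J = J' := by
  obtain ⟨p, hp⟩ := h.nonempty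
  obtain ⟨q, hq, hqp⟩ := h.exists_ne p
  obtain ⟨γ, hγ, rfl, s, hs, rfl, harc⟩ :=
    h'.exists_param_arc_subset hqp.symm hsub h.isPreconnected hp hq
  refine hsub.antisymm ?_
  -- A point inside the arc already found in `J`. Without it `J` is still connected, so it must join
  -- the two ends along the other arc.
  set m := (s + 1) / 2 with hm
  have hmJ : γ m ∈ J := harc ⟨m, ⟨by linarith [hs.2], by linarith [hs.2]⟩, rfl⟩
  have hne : ∀ t ∈ Ico (0 : ℝ) 1, γ t = γ m → t = m := fun t ht =>
    hγ.injOn (a := 0) ⟨ht.1, by linarith [ht.2]⟩ ⟨by linarith [hs.1], by linarith [hs.2]⟩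
  have h0 : γ 0 ∈ J \ {γ m} := ⟨hp, fun h => by
    have := hne 0 (by simp) h; linarith [hs.1]⟩
  have h1 : γ s ∈ J \ {γ m} := ⟨hq, fun h => by
    have := hne s ⟨hs.1.le, hs.2⟩ h; linarith [hs.2]⟩
  have hJ' : J' = γ '' Icc 0 s ∪ γ '' Icc s 1 := by
    rw [← image_union, Icc_union_Icc_eq_Icc hs.1.le hs.2.le, hγ.image_Icc]
  rw [hJ']
  rcases hγ.arc_subset hs (sdiff_subset.trans hsub) (h.isPreconnected_diff_singleton hmJ) h0 h1
    with h2 | h2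
  · exact union_subset (h2.trans sdiff_subset) harc
  · exact absurd rfl (h2 ⟨m, ⟨by linarith [hs.2], by linarith [hs.2]⟩, rfl⟩).2

/-- If a simple loop is covered by two closed sets, then one of them suffices or there are two
points of the loop that lie in both. -/
theorem exists_two_mem_inter (h : IsSimpleLoop J) {U V : Set X} (hU : IsClosed U)
    (hV : IsClosed V) (hcov : J ⊆ U ∪ V) (hJU : ¬ J ⊆ U) (hJV : ¬ J ⊆ V) :
    ∃ p ∈ J ∩ (U ∩ V), ∃ q ∈ J ∩ (U ∩ V), p ≠ q := by
  by_contra! hcon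
  -- The only common point, or any point if there is none. Removing it leaves the loop connected,
  -- while the two closed sets become disjoint on it.
  obtain ⟨p, hp, hpU⟩ : ∃ p ∈ J, J ∩ (U ∩ V) ⊆ {p} := by
    rcases (J ∩ (U ∩ V)).eq_empty_or_nonempty with h0 | ⟨p, hp⟩
    · obtain ⟨p, hp⟩ := h.nonempty
      exact ⟨p, hp, by simp [h0]⟩
    · exact ⟨p, hp.1, fun q hq => hcon q hq p hp⟩
  have key := isPreconnected_closed_iff.1 (h.isPreconnected_diff_singleton hp) U V hU hV
    (sdiff_subset.trans hcov)
  by_cases hUn : ((J \ {p}) ∩ U).Nonempty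
  · by_cases hVn : ((J \ {p}) ∩ V).Nonempty
    · obtain ⟨x, hx, hxUV⟩ := key hUn hVn
      exact hx.2 (hpU ⟨hx.1, hxUV⟩)
    · refine hJU (h.subset_of_diff_singleton_subset hp hU fun x hx => ?_)
      exact (hcov hx.1).resolve_right fun hxV => hVn ⟨x, hx, hxV⟩
  · refine hJV (h.subset_of_diff_singleton_subset hp hV fun x hx => ?_)
    exact (hcov hx.1).resolve_left fun hxV => hUn ⟨x, hx, hxV⟩

/-- Two preconnected subsets of a simple loop that share two points but only finitely many points
cover the loop. -/
theorem subset_union_of_finite_inter [T2Space X] (h : IsSimpleLoop J) {p q : X} (hpq : p ≠ q)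
    {S₁ S₂ : Set X} (hS₁J : S₁ ⊆ J) (hS₂J : S₂ ⊆ J) (hS₁ : IsPreconnected S₁)
    (hS₂ : IsPreconnected S₂) (hp₁ : p ∈ S₁) (hq₁ : q ∈ S₁) (hp₂ : p ∈ S₂) (hq₂ : q ∈ S₂)
    (hfin : (S₁ ∩ S₂).Finite) : J ⊆ S₁ ∪ S₂ := by
  obtain ⟨γ, hγ, rfl, s, hs, rfl, harc⟩ := h.exists_param_arc_subset hpq hS₁J hS₁ hp₁ hq₁
  have hJ' : J = γ '' Icc s 1 ∪ γ '' Icc 0 s := by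
    rw [union_comm, ← image_union, Icc_union_Icc_eq_Icc hs.1.le hs.2.le, hγ.image_Icc]
  rw [hJ']
  rcases hγ.arc_subset hs hS₂J hS₂ hp₂ hq₂ with h2 | h2
  · exact union_subset_union harc h2
  · refine absurd (hfin.subset ?_) (hγ.image_Ioo_infinite hs.1.le hs.2 le_rfl)
    exact (image_mono Ioo_subset_Icc_self).trans (subset_inter harc h2)

/-- A homeomorphic image of a simple loop is a simple loop. -/
theorem image {Y : Type*} [TopologicalSpace Y] (h : IsSimpleLoop J) (f : X ≃ₜ Y) :
    IsSimpleLoop (f '' J) := by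
  obtain ⟨γ, hγ⟩ := h
  refine ⟨f ∘ γ, f.continuous.comp hγ.continuous, fun s t => ?_, ?_⟩
  · simp [hγ.eq_iff]
  · rw [range_comp, hγ.range_eq]

end IsSimpleLoop

/-! ### Frontiers and connectedness in the plane -/

/-- A preconnected set that misses the frontier of `K` and meets `K` lies in the interior. -/
theorem IsPreconnected.subset_interior {X : Type*} [TopologicalSpace X] {S K : Set X}
    (hS : IsPreconnected S) (hd : Disjoint S (frontier K)) (hne : (S ∩ K).Nonempty) :
    S ⊆ interior K := by
  have hcov : S ⊆ interior K ∪ (closure K)ᶜ := by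
    intro x hx
    by_contra! hcon
    rw [mem_union, not_or, notMem_compl_iff] at hcon
    exact disjoint_left.1 hd hx ⟨hcon.2, hcon.1⟩
  refine hS.subset_left_of_subset_union isOpen_interior isClosed_closure.isOpen_compl ?_ hcov ?_
  · exact disjoint_left.2 fun x hx hx' => hx' (subset_closure (interior_subset hx))
  · obtain ⟨x, hxS, hxK⟩ := hne
    exact ⟨x, hxS, (hcov hxS).resolve_right fun h => h (subset_closure hxK)⟩

/-- A bounded subset of the plane with nonempty interior has infinite frontier. -/
theorem infinite_frontier_of_isBounded {K : Set Plane} (hK : Bornology.IsBounded K)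
    (hint : (interior K).Nonempty) : (frontier K).Infinite := by
  intro hfin
  have hrank : 1 < Module.rank ℝ Plane := by
    rw [← Module.finrank_eq_rank]
    simp
  -- A finite frontier would not separate the plane, so its complement could not contain points both
  -- inside and outside `K`.
  have hconn := (hfin.countable.isConnected_compl_of_one_lt_rank hrank).isPreconnected
  obtain ⟨x, hx⟩ := hint
  have hunb : ¬ Bornology.IsBounded (K ∪ frontier K)ᶜ := by
    intro hb
    have hb2 := (hK.union hfin.isBounded).union hb
    rw [union_compl_self] at hb2
    exact NormedSpace.unbounded_univ ℝ Plane hb2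
  obtain ⟨y, hy⟩ : ((K ∪ frontier K)ᶜ).Nonempty := by
    by_contra h
    rw [not_nonempty_iff_eq_empty] at h
    exact hunb (h ▸ Bornology.isBounded_empty)
  rw [compl_union] at hy
  have := hconn.subset_interior (K := K) disjoint_compl_left ⟨x, fun h => h.2 hx, interior_subset hx⟩
  exact hy.1 (interior_subset (this hy.2))

/-! ### Tangent graphs and inner half-planes -/

/-- Every direction of an open half-plane leads from `p` into the interior of `K`. -/
def HasInnerHalfplane (K : Set Plane) (p : Plane) : Prop :=
  ∃ n : Plane, n ≠ 0 ∧ ∀ u : Plane, 0 < ⟪n, u⟫ → ∀ᶠ t : ℝ in 𝓝[>] 0, p + t • u ∈ interior K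

/-- `τ` and `n` form an orthonormal basis of the plane. -/
structure IsFrame (τ n : Plane) : Prop where
  tt : ⟪τ, τ⟫ = 1
  nn : ⟪n, n⟫ = 1
  tn : ⟪τ, n⟫ = 0
  decomp : ∀ w : Plane, w = ⟪τ, w⟫ • τ + ⟪n, w⟫ • n

/-- Near `p`, the set `J` is a graph over the line through `p` of direction `τ`, and it is tangent
to this line at `p`. -/
structure IsGraphAt (J : Set Plane) (p τ n : Plane) : Prop where
  frame : IsFrame τ n
  injOn : ∀ᶠ ρ : ℝ in 𝓝[>] 0, ∀ w ∈ J, ∀ w' ∈ J, dist w p < ρ → dist w' p < ρ →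
    ⟪τ, w⟫ = ⟪τ, w'⟫ → w = w'
  tangent : ∀ η : ℝ, 0 < η → ∀ᶠ ρ : ℝ in 𝓝[>] 0, ∀ w ∈ J, dist w p < ρ →
    |⟪n, w - p⟫| ≤ η * |⟪τ, w - p⟫|

theorem exists_isFrame {τ : Plane} (hτ : ‖τ‖ = 1) : ∃ n, IsFrame τ n := by
  have h1 : τ 0 * τ 0 + τ 1 * τ 1 = 1 := by
    have := EuclideanSpace.real_norm_sq_eq τ
    rw [hτ, Fin.sum_univ_two] at this
    linarith
  refine ⟨!₂[-τ 1, τ 0], ?_, ?_, ?_, fun w => ?_⟩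
  · rw [real_inner_self_eq_norm_sq, hτ, one_pow]
  · rw [real_inner_self_eq_norm_sq, EuclideanSpace.real_norm_sq_eq]
    simp [Fin.sum_univ_two]
    linarith
  · simp [PiLp.inner_apply, Fin.sum_univ_two]
    ring
  · ext i
    fin_cases i
    · simp [PiLp.inner_apply, Fin.sum_univ_two]
      linear_combination (-w 0) * h1
    · simp [PiLp.inner_apply, Fin.sum_univ_two]
      linear_combination (-w 1) * h1

namespace IsFrame

variable {τ n : Plane}

theorem norm_t (h : IsFrame τ n) : ‖τ‖ = 1 := by
  have := h.tt
  rw [real_inner_self_eq_norm_sq] at this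
  nlinarith [norm_nonneg τ]

theorem norm_n (h : IsFrame τ n) : ‖n‖ = 1 := by
  have := h.nn
  rw [real_inner_self_eq_norm_sq] at this
  nlinarith [norm_nonneg n]

theorem neg (h : IsFrame τ n) : IsFrame τ (-n) where
  tt := h.tt
  nn := by rw [inner_neg_neg, h.nn]
  tn := by simp [h.tn]
  decomp w := by simpa using h.decomp w

theorem norm_le (h : IsFrame τ n) (w : Plane) : ‖w‖ ≤ |⟪τ, w⟫| + |⟪n, w⟫| := by
  calc ‖w‖ = ‖⟪τ, w⟫ • τ + ⟪n, w⟫ • n‖ := by rw [← h.decomp w]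
    _ ≤ _ := norm_add_le _ _
    _ = _ := by simp [norm_smul, h.norm_t, h.norm_n]

end IsFrame

namespace IsGraphAt

variable {J K : Set Plane} {p τ n : Plane}

theorem neg (h : IsGraphAt J p τ n) : IsGraphAt J p τ (-n) where
  frame := h.frame.neg
  injOn := h.injOn
  tangent η hη := by simpa using h.tangent η hη

/-- The part above the tangent line, outside a flat double sector, of a small square. -/
def upperSector (p τ n : Plane) (a η : ℝ) : Set Plane :=
  {w | |⟪τ, w - p⟫| < a ∧ ⟪n, w - p⟫ < a ∧ η * |⟪τ, w - p⟫| < ⟪n, w - p⟫}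

theorem convex_upperSector {a η : ℝ} (hη : 0 ≤ η) : Convex ℝ (upperSector p τ n a η) := by
  rw [convex_iff_forall_pos]
  rintro x ⟨hx1, hx2, hx3⟩ y ⟨hy1, hy2, hy3⟩ s t hs ht hst
  have hd : s • x + t • y - p = s • (x - p) + t • (y - p) := by
    have : p = s • p + t • p := by rw [← add_smul, hst, one_smul]
    nth_rw 1 [this]
    module
  have hab : |s * ⟪τ, x - p⟫ + t * ⟪τ, y - p⟫| ≤ s * |⟪τ, x - p⟫| + t * |⟪τ, y - p⟫| := by
    refine (abs_add_le _ _).trans ?_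
    rw [abs_mul, abs_mul, abs_of_pos hs, abs_of_pos ht]
  have e1 : a = s * a + t * a := by rw [← add_mul, hst, one_mul]
  refine ⟨?_, ?_, ?_⟩ <;> rw [hd] <;> simp only [inner_add_right, inner_smul_right]
  · rw [e1]
    exact hab.trans_lt (add_lt_add (mul_lt_mul_of_pos_left hx1 hs) (mul_lt_mul_of_pos_left hy1 ht))
  · rw [e1]
    exact add_lt_add (mul_lt_mul_of_pos_left hx2 hs) (mul_lt_mul_of_pos_left hy2 ht)
  · calc _ ≤ η * (s * |⟪τ, x - p⟫| + t * |⟪τ, y - p⟫|) := mul_le_mul_of_nonneg_left hab hη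
      _ = s * (η * |⟪τ, x - p⟫|) + t * (η * |⟪τ, y - p⟫|) := by ring
      _ < _ := add_lt_add (mul_lt_mul_of_pos_left hx3 hs) (mul_lt_mul_of_pos_left hy3 ht)

/-- In a small square, `J` is a graph over the tangent. -/
structure IsBox (J : Set Plane) (p τ n : Plane) (a η : ℝ) : Prop where
  frame : IsFrame τ n
  pos : 0 < a
  injOn : ∀ w ∈ J, ∀ w' ∈ J, |⟪τ, w - p⟫| < a → |⟪n, w - p⟫| < a → |⟪n, w' - p⟫| < a →
    ⟪τ, w⟫ = ⟪τ, w'⟫ → w = w'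
  tangent : ∀ w ∈ J, |⟪τ, w - p⟫| < a → |⟪n, w - p⟫| < a → |⟪n, w - p⟫| ≤ η * |⟪τ, w - p⟫|

theorem exists_isBox (h : IsGraphAt J p τ n) {η : ℝ} (hη : 0 < η) : ∃ a, IsBox J p τ n a η := by
  obtain ⟨ρ, ⟨h1, h2⟩, hρ⟩ := ((h.injOn.and (h.tangent η hη)).and self_mem_nhdsWithin).exists
  have hρ : 0 < ρ := hρ
  have hd : ∀ w, |⟪τ, w - p⟫| < ρ / 2 → |⟪n, w - p⟫| < ρ / 2 → dist w p < ρ := by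
    intro w hw1 hw2
    rw [dist_eq_norm]
    linarith [h.frame.norm_le (w - p)]
  refine ⟨ρ / 2, h.frame, by positivity, ?_, fun w hw hw1 hw2 => h2 w hw (hd w hw1 hw2)⟩
  intro w hw w' hw' hw1 hw2 hw3 heq
  refine h1 w hw w' hw' (hd w hw1 hw2) (hd w' ?_ hw3) heq
  rw [inner_sub_right] at hw1 ⊢
  rwa [← heq]

theorem IsBox.neg {a η : ℝ} (h : IsBox J p τ n a η) : IsBox J p τ (-n) a η where
  frame := h.frame.neg
  pos := h.pos
  injOn w hw w' hw' := by simpa using h.injOn w hw w' hw'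
  tangent w hw := by simpa using h.tangent w hw

theorem IsBox.disjoint_upperSector {a η : ℝ} (hη : 0 ≤ η) (h : IsBox J p τ n a η) :
    Disjoint (upperSector p τ n a η) J := by
  refine disjoint_left.2 fun w hw hwJ => ?_
  have h0 : 0 < ⟪n, w - p⟫ := lt_of_le_of_lt (by positivity) hw.2.2
  have habs := abs_of_pos h0
  have := h.tangent w hwJ hw.1 (by rw [habs]; exact hw.2.1)
  rw [habs] at this
  linarith [hw.2.2]

/-- The vertical segment above a point of the square. -/
def upperSegment (p n : Plane) (a : ℝ) (w : Plane) : Set Plane :=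
  (fun s : ℝ => w + s • n) '' Ioo 0 (a - ⟪n, w - p⟫)

theorem isPreconnected_upperSegment (a : ℝ) (w : Plane) :
    IsPreconnected (upperSegment p n a w) :=
  isPreconnected_Ioo.image _ (by fun_prop)

theorem IsBox.inner_n {a η : ℝ} (h : IsBox J p τ n a η) (w : Plane) (s : ℝ) :
    ⟪n, w + s • n - p⟫ = ⟪n, w - p⟫ + s := by
  rw [show w + s • n - p = (w - p) + s • n by abel, inner_add_right, inner_smul_right, h.frame.nn]
  ring

theorem IsBox.inner_t {a η : ℝ} (h : IsBox J p τ n a η) (w : Plane) (s : ℝ) :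
    ⟪τ, w + s • n - p⟫ = ⟪τ, w - p⟫ := by
  rw [show w + s • n - p = (w - p) + s • n by abel, inner_add_right, inner_smul_right, h.frame.tn]
  ring

theorem IsBox.upperSegment_meets {a η : ℝ} (hη' : η ≤ 1) (h : IsBox J p τ n a η) {w : Plane}
    (hw1 : |⟪τ, w - p⟫| < a) (hw2 : |⟪n, w - p⟫| < a) :
    (upperSegment p n a w ∩ upperSector p τ n a η).Nonempty := by
  set y := ⟪n, w - p⟫
  set x := ⟪τ, w - p⟫ with hx
  have hxa : η * |x| < a := lt_of_le_of_lt (mul_le_of_le_one_left (abs_nonneg x) hη') hw1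
  have hm : max y (η * |x|) < a := max_lt (lt_of_le_of_lt (le_abs_self _) hw2) hxa
  have hy := le_max_left y (η * |x|)
  have hy' := le_max_right y (η * |x|)
  set m := max y (η * |x|)
  refine ⟨w + ((a + m) / 2 - y) • n, ⟨_, ⟨by linarith, ?_⟩, rfl⟩, ?_, ?_, ?_⟩
  · change _ < a - y
    linarith
  · rw [h.inner_t]
    exact hw1
  · rw [h.inner_n]
    change y + _ < a
    linarith
  · rw [h.inner_n, h.inner_t]
    change η * |x| < y + _
    linarith

/-- The vertical segment carries the interior from `w` into the sector. The sector is convex and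
misses the frontier, so it is inside as a whole. -/
theorem IsBox.upperSector_subset {a η : ℝ} (hη : 0 ≤ η) (hη' : η ≤ 1)
    (h : IsBox (frontier K) p τ n a η) {w : Plane} (hw : w ∈ interior K) (hw1 : |⟪τ, w - p⟫| < a)
    (hw2 : |⟪n, w - p⟫| < a) (hd : Disjoint (upperSegment p n a w) (frontier K)) :
    upperSector p τ n a η ⊆ interior K := by
  have hseg : upperSegment p n a w ⊆ interior K := by
    have h0 : IsPreconnected ((fun s : ℝ => w + s • n) '' Ico 0 (a - ⟪n, w - p⟫)) :=
      isPreconnected_Ico.image _ (by fun_prop)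
    have hpos : 0 < a - ⟪n, w - p⟫ := by linarith [le_abs_self ⟪n, w - p⟫]
    have hw0 : w ∈ (fun s : ℝ => w + s • n) '' Ico 0 (a - ⟪n, w - p⟫) :=
      ⟨0, ⟨le_rfl, hpos⟩, by simp⟩
    refine Subset.trans (image_mono Ioo_subset_Ico_self)
      (h0.subset_interior (disjoint_left.2 ?_) ⟨w, hw0, interior_subset hw⟩)
    rintro _ ⟨s, hs, rfl⟩ hf
    rcases eq_or_lt_of_le hs.1 with rfl | hs0
    · simp only [zero_smul, add_zero] at hf
      exact hf.2 hw
    · exact disjoint_left.1 hd ⟨s, ⟨hs0, hs.2⟩, rfl⟩ hf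
  obtain ⟨z, hz1, hz2⟩ := h.upperSegment_meets hη' hw1 hw2
  exact (convex_upperSector hη).isPreconnected.subset_interior (h.disjoint_upperSector hη)
    ⟨z, hz2, interior_subset (hseg hz1)⟩

/-- On one side of the graph the set fills a sector. -/
theorem exists_upperSector_subset {a η : ℝ} (hη : 0 ≤ η) (hη' : η ≤ 1)
    (h : IsBox (frontier K) p τ n a η) (hp : p ∈ closure (interior K)) :
    upperSector p τ n a η ⊆ interior K ∨ upperSector p τ (-n) a η ⊆ interior K := by
  obtain ⟨w, ⟨hw1, hw2⟩, hw⟩ : ({w : Plane | |⟪τ, w - p⟫| < a ∧ |⟪n, w - p⟫| < a} ∩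
      interior K).Nonempty := by
    refine mem_closure_iff.1 hp _ (IsOpen.and ?_ ?_) ?_
    · exact isOpen_lt (by fun_prop) (by fun_prop)
    · exact isOpen_lt (by fun_prop) (by fun_prop)
    · simp [h.pos]
  by_cases hd : Disjoint (upperSegment p n a w) (frontier K)
  · exact Or.inl (h.upperSector_subset hη hη' hw hw1 hw2 hd)
  right
  -- A vertical line meets the frontier at most once in the box. As it does so above `w`, the way
  -- down is free.
  refine h.neg.upperSector_subset hη hη' hw hw1 (by simpa using hw2) (disjoint_left.2 ?_)
  rintro _ ⟨t, ht, rfl⟩ hf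
  obtain ⟨_, ⟨s, hs, rfl⟩, hf'⟩ := not_disjoint_iff.1 hd
  simp only [inner_neg_left, sub_neg_eq_add] at ht
  have hw2' := abs_lt.1 hw2
  have e1 := h.inner_n w s
  have e2 := h.inner_n w (-t)
  have e3 := h.inner_t w s
  have e4 := h.inner_t w (-t)
  simp only [smul_neg, neg_smul] at *
  have := h.injOn _ hf' _ hf (by rwa [e3]) (by rw [e1, abs_lt]; constructor <;> linarith [hs.1, hs.2])
    (by rw [e2, abs_lt]; constructor <;> linarith [ht.1, ht.2]) (by
      have := e3.trans e4.symm
      rwa [inner_sub_right, inner_sub_right, sub_left_inj] at this)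
  rw [this] at e1
  linarith [hs.1, ht.1]

/-- In the box, the vertical line through `w` meets the frontier only in `w`. So the segment above
`w` runs into the sector without crossing the frontier, and `w` is a limit of interior points. -/
theorem IsBox.mem_closure {a η : ℝ} (hη' : η ≤ 1)
    (h : IsBox (frontier K) p τ n a η) (hU : upperSector p τ n a η ⊆ interior K) {w : Plane}
    (hw : w ∈ frontier K) (hw1 : |⟪τ, w - p⟫| < a) (hw2 : |⟪n, w - p⟫| < a) :
    w ∈ closure (interior K) := by
  have hw2' := abs_lt.1 hw2
  have hseg : upperSegment p n a w ⊆ interior K := by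
    obtain ⟨z, hz1, hz2⟩ := h.upperSegment_meets hη' hw1 hw2
    refine (isPreconnected_upperSegment a w).subset_interior (disjoint_left.2 ?_)
      ⟨z, hz1, interior_subset (hU hz2)⟩
    rintro _ ⟨s, hs, rfl⟩ hf
    have e1 := h.inner_n w s
    have := h.injOn w hw _ hf hw1 hw2
      (by rw [e1, abs_lt]; constructor <;> linarith [hs.1, hs.2]) (by
        rw [inner_add_right, inner_smul_right, h.frame.tn]; ring)
    have e2 : ⟪n, w - p⟫ = ⟪n, w - p⟫ + s := Eq.trans (by nth_rw 1 [this]) e1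
    linarith [hs.1]
  have hlim : Tendsto (fun s : ℝ => w + s • n) (𝓝[>] 0) (𝓝 w) := by
    have : Tendsto (fun s : ℝ => w + s • n) (𝓝 0) (𝓝 (w + (0 : ℝ) • n)) :=
      Continuous.tendsto (by fun_prop) 0
    simp only [zero_smul, add_zero] at this
    exact this.mono_left nhdsWithin_le_nhds
  refine mem_closure_of_tendsto hlim ?_
  filter_upwards [Ioo_mem_nhdsGT (show (0 : ℝ) < a - ⟪n, w - p⟫ by linarith)] with s hs
  exact hseg ⟨s, hs, rfl⟩

/-- The sector of slope 1 covers only directions within 45 degrees of `n`. A direction closer to the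
tangent needs a flatter sector in a box of its own; both sectors contain points straight above `p`,
so the flatter one is inside as well. -/
theorem hasInnerHalfplane_of_upperSector (h : IsGraphAt (frontier K) p τ n) {a : ℝ}
    (ha : IsBox (frontier K) p τ n a 1) (hU : upperSector p τ n a 1 ⊆ interior K) :
    HasInnerHalfplane K p := by
  have hnn := h.frame.nn
  refine ⟨n, by rintro rfl; simp at hnn, fun u hu => ?_⟩
  set η := ⟪n, u⟫ / (2 * (|⟪τ, u⟫| + 1)) with hηdef
  have hη : 0 < η := by positivity
  have hηu : η * |⟪τ, u⟫| < ⟪n, u⟫ := by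
    rw [hηdef, div_mul_eq_mul_div, div_lt_iff₀ (by positivity)]
    nlinarith [abs_nonneg ⟪τ, u⟫]
  obtain ⟨b, hb⟩ := h.exists_isBox hη
  have hsub : upperSector p τ n b η ⊆ interior K := by
    refine (convex_upperSector hη.le).isPreconnected.subset_interior
      (hb.disjoint_upperSector hη.le) ⟨p + (min a b / 2) • n, ⟨?_, ?_, ?_⟩,
        interior_subset (hU ⟨?_, ?_, ?_⟩)⟩ <;>
      simp [inner_smul_right, h.frame.tn, h.frame.norm_n, ha.pos, hb.pos] <;>
      have := lt_min ha.pos hb.pos <;>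
      linarith [min_le_left a b, min_le_right a b, ha.pos, hb.pos]
  have h1 : ∀ᶠ t : ℝ in 𝓝[>] 0, |t * ⟪τ, u⟫| < b := by
    refine nhdsWithin_le_nhds ?_
    have : Continuous fun t : ℝ => |t * ⟪τ, u⟫| := by fun_prop
    exact this.tendsto 0 |>.eventually (gt_mem_nhds (by simpa using hb.pos))
  have h2 : ∀ᶠ t : ℝ in 𝓝[>] 0, t * ⟪n, u⟫ < b := by
    refine nhdsWithin_le_nhds ?_
    have : Continuous fun t : ℝ => t * ⟪n, u⟫ := by fun_prop
    exact this.tendsto 0 |>.eventually (gt_mem_nhds (by simpa using hb.pos))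
  filter_upwards [h1, h2, self_mem_nhdsWithin] with t ht1 ht2 ht
  have ht : 0 < t := ht
  refine hsub ⟨?_, ?_, ?_⟩ <;> simp only [add_sub_cancel_left, inner_smul_right]
  · exact ht1
  · exact ht2
  · rw [abs_mul, abs_of_pos ht]
    nlinarith

theorem hasInnerHalfplane (h : IsGraphAt (frontier K) p τ n) (hp : p ∈ closure (interior K)) :
    HasInnerHalfplane K p := by
  obtain ⟨a, ha⟩ := h.exists_isBox one_pos
  rcases exists_upperSector_subset zero_le_one le_rfl ha hp with hU | hU
  · exact h.hasInnerHalfplane_of_upperSector ha hU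
  · exact h.neg.hasInnerHalfplane_of_upperSector ha.neg hU

/-- This says that the closure of the interior contains a neighborhood of `p` relative to the
frontier: the openness needed to argue by connectedness along the loop. -/
theorem mem_interior_union_compl (h : IsGraphAt (frontier K) p τ n)
    (hp : p ∈ closure (interior K)) :
    p ∈ interior (closure (interior K) ∪ (frontier K)ᶜ) := by
  obtain ⟨a, ha⟩ := h.exists_isBox one_pos
  rw [mem_interior]
  refine ⟨{w : Plane | |⟪τ, w - p⟫| < a ∧ |⟪n, w - p⟫| < a}, ?_, IsOpen.and ?_ ?_, ?_⟩
  · rintro w ⟨hw1, hw2⟩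
    by_cases hw : w ∈ frontier K
    · left
      rcases exists_upperSector_subset zero_le_one le_rfl ha hp with hU | hU
      · exact ha.mem_closure le_rfl hU hw hw1 hw2
      · exact ha.neg.mem_closure le_rfl hU hw hw1 (by simpa using hw2)
    · exact Or.inr hw
  · exact isOpen_lt (by fun_prop) (by fun_prop)
  · exact isOpen_lt (by fun_prop) (by fun_prop)
  · simp [ha.pos]

end IsGraphAt

/-- A compact set with nonempty interior, bounded by a simple loop that is a tangent graph near all
of its points but one, is the closure of its interior. -/
theorem subset_closure_interior_of_isGraphAt {K : Set Plane} (hK : IsCompact K)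
    (hint : (interior K).Nonempty) (hJ : IsSimpleLoop (frontier K)) {c : Plane}
    (hc : c ∈ frontier K)
    (hgraph : ∀ p ∈ frontier K, p ≠ c → ∃ τ n, IsGraphAt (frontier K) p τ n) :
    K ⊆ closure (interior K) := by
  have hconn := hJ.isPreconnected_diff_singleton hc
  have hsub : frontier K \ {c} ⊆ closure (interior K) := by
    intro p hp
    by_contra hpn
    -- Within the connected set `frontier K \ {c}`, lying in the closure of the interior is both an
    -- open and a closed condition. If it fails at `p`, it fails everywhere, and the frontier of the
    -- interior shrinks to `{c}`.
    have hcov : frontier K \ {c} ⊆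
        (closure (interior K))ᶜ ∪ interior (closure (interior K) ∪ (frontier K)ᶜ) := by
      intro q hq
      by_cases hqn : q ∈ closure (interior K)
      · obtain ⟨τ, n, hg⟩ := hgraph q hq.1 hq.2
        exact Or.inr (hg.mem_interior_union_compl hqn)
      · exact Or.inl hqn
    have hfin : (frontier (interior K)) ⊆ {c} := by
      intro q hq
      by_contra hqc
      have hqJ := frontier_interior_subset hq
      have hqcl := frontier_subset_closure hq
      obtain ⟨τ, n, hg⟩ := hgraph q hqJ hqc
      obtain ⟨x, hx, hx1, hx2⟩ := hconn _ _ isClosed_closure.isOpen_compl isOpen_interior hcov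
        ⟨p, hp, hpn⟩ ⟨q, ⟨hqJ, hqc⟩, hg.mem_interior_union_compl hqcl⟩
      rcases interior_subset hx2 with h | h
      · exact hx1 h
      · exact h hx.1
    exact infinite_frontier_of_isBounded (hK.isBounded.subset interior_subset)
      (by rwa [interior_interior]) ((finite_singleton c).subset hfin)
  have hJK := hJ.subset_of_diff_singleton_subset hc isClosed_closure hsub
  intro x hx
  by_cases hxi : x ∈ interior K
  · exact subset_closure hxi
  · exact hJK ⟨subset_closure hx, hxi⟩

/-! ### Regular points of parametrized curves -/

/-- Points of a simple loop near `γ t` have parameters near `t`. -/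
theorem IsLoopParam.eventually_exists_near {X : Type*} [TopologicalSpace X] [T2Space X] {J : Set X}
    {γ : ℝ → X} (h : IsLoopParam J γ) {t₀ : ℝ} {U : Set ℝ} (hU : U ∈ 𝓝 t₀) :
    ∀ᶠ w in 𝓝 (γ t₀), w ∈ J → ∃ t ∈ U, γ t = w := by
  obtain ⟨U', hU'U, hU'o, ht₀⟩ := mem_nhds_iff.1 hU
  -- A full period centred at `t₀`, minus the neighborhood: its image is compact and misses `γ t₀`.
  have hcpt : IsCompact (Icc (t₀ - 1 / 2) (t₀ - 1 / 2 + 1) \ U') := isCompact_Icc.diff hU'o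
  have hcl := (hcpt.image h.continuous).isClosed
  have hnot : γ t₀ ∉ γ '' (Icc (t₀ - 1 / 2) (t₀ - 1 / 2 + 1) \ U') := by
    rintro ⟨t, ⟨ht, htU⟩, hγ⟩
    obtain ⟨n, hn⟩ := (h.eq_iff _ _).1 hγ
    have h1 : (n : ℝ) < 1 := by linarith [ht.1]
    have h2 : (-1 : ℝ) < n := by linarith [ht.2]
    have h1' : n < 1 := by exact_mod_cast h1
    have h2' : -1 < n := by exact_mod_cast h2
    have : n = 0 := by omega
    simp only [this, Int.cast_zero, add_zero] at hn
    exact htU (hn ▸ ht₀)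
  filter_upwards [hcl.isOpen_compl.mem_nhds hnot] with w hw hwJ
  obtain ⟨t, ht, rfl⟩ := h.exists_Ico (t₀ - 1 / 2) hwJ
  refine ⟨t, hU'U ?_, rfl⟩
  by_contra htU
  exact hw ⟨t, ⟨⟨ht.1, ht.2.le⟩, htU⟩, rfl⟩

/-- The curve `γ` is at `t` strictly monotone in the direction `τ`, and tangent to it. -/
structure IsRegularAt (γ : ℝ → Plane) (t₀ : ℝ) (τ n : Plane) : Prop where
  frame : IsFrame τ n
  strictMonoOn : ∃ ε > 0, StrictMonoOn (fun t => ⟪τ, γ t⟫) (Icc (t₀ - ε) (t₀ + ε))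
  tangent : ∀ η : ℝ, 0 < η → ∀ᶠ t in 𝓝 t₀, |⟪n, γ t - γ t₀⟫| ≤ η * |⟪τ, γ t - γ t₀⟫|

theorem IsRegularAt.comp_mul {γ : ℝ → Plane} {t₀ : ℝ} {τ n : Plane} {v : ℝ} (hv : 0 < v)
    (h : IsRegularAt γ (v * t₀) τ n) : IsRegularAt (fun t => γ (v * t)) t₀ τ n where
  frame := h.frame
  strictMonoOn := by
    obtain ⟨ε, hε, hmono⟩ := h.strictMonoOn
    have key : ∀ t ∈ Icc (t₀ - ε / v) (t₀ + ε / v), v * t ∈ Icc (v * t₀ - ε) (v * t₀ + ε) := by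
      intro t ht
      have : v * (ε / v) = ε := by field_simp
      constructor <;> nlinarith [ht.1, ht.2]
    exact ⟨ε / v, by positivity, fun s hs t ht hst =>
      hmono (key s hs) (key t ht) (mul_lt_mul_of_pos_left hst hv)⟩
  tangent η hη := by
    have : Tendsto (fun t : ℝ => v * t) (𝓝 t₀) (𝓝 (v * t₀)) := Continuous.tendsto (by fun_prop) _
    exact this.eventually (h.tangent η hη)

/-- Points of the loop near `γ t₀` have parameters near `t₀`, so no other branch comes close and
local properties of the curve pass to the set. -/
theorem IsRegularAt.isGraphAt {J : Set Plane} {γ : ℝ → Plane} (hJ : IsLoopParam J γ) {t₀ : ℝ}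
    {τ n : Plane} (h : IsRegularAt γ t₀ τ n) : IsGraphAt J (γ t₀) τ n := by
  have key : ∀ U ∈ 𝓝 t₀, ∀ᶠ ρ : ℝ in 𝓝[>] 0, ∀ w ∈ J, dist w (γ t₀) < ρ → ∃ t ∈ U, γ t = w := by
    intro U hU
    obtain ⟨δ, hδ, hball⟩ := Metric.eventually_nhds_iff.1 (hJ.eventually_exists_near hU)
    filter_upwards [Ioo_mem_nhdsGT hδ] with ρ hρ w hw hd
    exact hball (hd.trans hρ.2) hw
  refine ⟨h.frame, ?_, fun η hη => ?_⟩
  · obtain ⟨ε, hε, hmono⟩ := h.strictMonoOn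
    filter_upwards [key _ (Icc_mem_nhds (by linarith) (by linarith) :
      Icc (t₀ - ε) (t₀ + ε) ∈ 𝓝 t₀)] with ρ hρ w hw w' hw' hd hd' heq
    obtain ⟨t, ht, rfl⟩ := hρ w hw hd
    obtain ⟨t', ht', rfl⟩ := hρ w' hw' hd'
    rw [hmono.injOn ht ht' heq]
  · filter_upwards [key _ (h.tangent η hη)] with ρ hρ w hw hd
    obtain ⟨t, ht, rfl⟩ := hρ w hw hd
    exact ht

theorem eventually_abs_le_of_hasDerivWithinAt {f g : ℝ → ℝ} {S : Set ℝ} {t₀ r η : ℝ} (hr : 0 < r)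
    (hη : 0 < η) (hf : HasDerivWithinAt f 0 S t₀) (hg : HasDerivWithinAt g r S t₀) :
    ∀ᶠ t in 𝓝[S] t₀, |f t - f t₀| ≤ η * |g t - g t₀| := by
  have h1 := (hasDerivWithinAt_iff_isLittleO.1 hf).bound (show 0 < η * (r / 2) by positivity)
  have h2 := (hasDerivWithinAt_iff_isLittleO.1 hg).bound (show 0 < r / 2 by positivity)
  filter_upwards [h1, h2] with t ht1 ht2
  simp only [smul_eq_mul, mul_zero, sub_zero, Real.norm_eq_abs] at ht1 ht2
  have h3 : |(t - t₀) * r| ≤ |g t - g t₀| + |g t - g t₀ - (t - t₀) * r| := by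
    have := abs_sub (g t - g t₀) (g t - g t₀ - (t - t₀) * r)
    rwa [sub_sub_cancel] at this
  rw [abs_mul, abs_of_pos hr] at h3
  calc _ ≤ η * (r / 2) * |t - t₀| := ht1
    _ = η * (r / 2 * |t - t₀|) := by ring
    _ ≤ _ := mul_le_mul_of_nonneg_left (by linarith) hη.le

/-- The one-sided velocities need only agree in direction. The factor `r` admits different speeds,
as at a vertex where two arcs meet at 180 degrees. -/
theorem isRegularAt_of_hasDerivWithinAt {γ : ℝ → Plane} {t₀ : ℝ} {d : Plane} (hd : d ≠ 0) {r : ℝ}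
    (hr : 0 < r) (hR : HasDerivWithinAt γ d (Ici t₀) t₀)
    (hL : HasDerivWithinAt γ (r • d) (Iic t₀) t₀)
    (hRm : ∃ ε > 0, StrictMonoOn (fun t => ⟪d, γ t⟫) (Icc t₀ (t₀ + ε)))
    (hLm : ∃ ε > 0, StrictMonoOn (fun t => ⟪d, γ t⟫) (Icc (t₀ - ε) t₀)) :
    ∃ τ n, IsRegularAt γ t₀ τ n := by
  have hd' : 0 < ‖d‖ := norm_pos_iff.2 hd
  set τ := ‖d‖⁻¹ • d with hτ
  have hdτ : d = ‖d‖ • τ := by rw [hτ, smul_smul, mul_inv_cancel₀ hd'.ne', one_smul]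
  obtain ⟨n, hn⟩ := exists_isFrame (τ := τ) (by rw [hτ, norm_smul, norm_inv, norm_norm,
    inv_mul_cancel₀ hd'.ne'])
  have hnt : ⟪n, τ⟫ = 0 := by rw [real_inner_comm]; exact hn.tn
  have hinner : ∀ (u d' : Plane) (S : Set ℝ), HasDerivWithinAt γ d' S t₀ →
      HasDerivWithinAt (fun t => ⟪u, γ t⟫) ⟪u, d'⟫ S t₀ := fun u d' S h => by
    simpa using (hasDerivWithinAt_const t₀ S u).inner ℝ h
  refine ⟨τ, n, hn, ?_, fun η hη => ?_⟩
  · obtain ⟨ε, hε, h1⟩ := hRm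
    obtain ⟨ε', hε', h2⟩ := hLm
    set m := min ε ε'
    have hm : 0 < m := lt_min hε hε'
    have hu : StrictMonoOn (fun t => ⟪d, γ t⟫) (Icc (t₀ - m) t₀ ∪ Icc t₀ (t₀ + m)) := by
      refine StrictMonoOn.union (c := t₀) (h2.mono ?_) (h1.mono ?_)
        (isGreatest_Icc (by linarith)) (isLeast_Icc (by linarith))
      · exact Icc_subset_Icc (by linarith [min_le_right ε ε']) le_rfl
      · exact Icc_subset_Icc le_rfl (by linarith [min_le_left ε ε'])
    rw [Icc_union_Icc_eq_Icc (by linarith) (by linarith)] at hu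
    refine ⟨m, hm, fun s hs t ht hst => ?_⟩
    have := hu hs ht hst
    simp only at this ⊢
    rw [hτ, real_inner_smul_left, real_inner_smul_left]
    exact mul_lt_mul_of_pos_left this (by positivity)
  · have key : ∀ (S : Set ℝ) (r' : ℝ), 0 < r' → HasDerivWithinAt γ (r' • τ) S t₀ →
        ∀ᶠ t in 𝓝[S] t₀, |⟪n, γ t - γ t₀⟫| ≤ η * |⟪τ, γ t - γ t₀⟫| := by
      intro S r' hr' h
      have h1 := hinner n _ S h
      have h2 := hinner τ _ S h
      rw [inner_smul_right, hnt, mul_zero] at h1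
      rw [inner_smul_right, hn.tt, mul_one] at h2
      simpa only [inner_sub_right] using eventually_abs_le_of_hasDerivWithinAt hr' hη h1 h2
    rw [← nhdsLE_sup_nhdsGE, eventually_sup]
    refine ⟨key _ (r * ‖d‖) (by positivity) ?_, key _ ‖d‖ hd' ?_⟩
    · rwa [mul_smul, ← hdτ]
    · rwa [← hdτ]

namespace IsC2Arc

variable {γ : ℝ → Plane}

theorem hasDerivWithinAt (h : IsC2Arc γ) {s : ℝ} (hs : s ∈ Icc (0 : ℝ) 1) :
    HasDerivWithinAt γ (derivWithin γ (Icc 0 1) s) (Icc 0 1) s :=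
  ((h.contDiff_one.differentiableOn one_ne_zero) s hs).hasDerivWithinAt

theorem exists_strictMonoOn (h : IsC2Arc γ) {s : ℝ} (hs : s ∈ Icc (0 : ℝ) 1) {u : Plane}
    (hu : 0 < ⟪u, derivWithin γ (Icc 0 1) s⟫) :
    ∃ δ > 0, StrictMonoOn (fun t => ⟪u, γ t⟫) (Icc 0 1 ∩ Icc (s - δ) (s + δ)) := by
  have hcont : ContinuousOn (fun t => ⟪u, derivWithin γ (Icc 0 1) t⟫) (Icc 0 1) :=
    continuousOn_const.inner (h.contDiff_one.continuousOn_derivWithin (uniqueDiffOn_Icc one_pos)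
      le_rfl)
  obtain ⟨δ, hδ, hball⟩ := Metric.mem_nhdsWithin_iff.1
    ((hcont s hs).eventually (lt_mem_nhds hu))
  refine ⟨δ / 2, by positivity, strictMonoOn_of_deriv_pos ?_ ?_ fun t ht => ?_⟩
  · exact (convex_Icc _ _).inter (convex_Icc _ _)
  · exact continuousOn_const.inner (h.contDiff_one.continuousOn.mono inter_subset_left)
  · have htI := interior_subset ht
    have hnhds : Icc (0 : ℝ) 1 ∈ 𝓝 t :=
      mem_of_superset (mem_interior_iff_mem_nhds.1 ht) inter_subset_left
    have hder := (h.hasDerivWithinAt htI.1).hasDerivAt hnhds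
    have hder' : HasDerivAt (fun t => ⟪u, γ t⟫) ⟪u, derivWithin γ (Icc 0 1) t⟫ t := by
      simpa using (hasDerivAt_const t u).inner ℝ hder
    rw [hder'.deriv]
    refine hball ⟨?_, htI.1⟩
    rw [Metric.mem_ball, Real.dist_eq, abs_lt]
    constructor <;> linarith [htI.2.1, htI.2.2]

end IsC2Arc

/-! ### The cell boundary as one closed curve -/

/-- The residue of an integer as an element of `Fin v`. -/
def cyclicIndex (v : ℕ) [NeZero v] (m : ℤ) : Fin v := Fin.ofNat v (m % v).toNat

section cyclicIndex

variable {v : ℕ} [NeZero v]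

theorem cyclicIndex_val (m : ℤ) : ((cyclicIndex v m : ℕ) : ℤ) = m % v := by
  have hv : (0 : ℤ) < v := by exact_mod_cast Nat.pos_of_ne_zero (NeZero.ne v)
  have h1 := Int.emod_nonneg m hv.ne'
  have h2 := Int.emod_lt_of_pos m hv
  have h3 : (m % v).toNat < v := by omega
  simp only [cyclicIndex, Fin.ofNat, Nat.mod_eq_of_lt h3]
  omega

theorem cyclicIndex_eq_iff (m n : ℤ) :
    cyclicIndex v m = cyclicIndex v n ↔ ∃ q : ℤ, n = m + v * q := by
  rw [← Fin.val_inj, ← Nat.cast_inj (R := ℤ), cyclicIndex_val, cyclicIndex_val]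
  change m ≡ n [ZMOD v] ↔ _
  rw [Int.modEq_iff_dvd]
  exact exists_congr fun q => ⟨fun h => by linarith, fun h => by linarith⟩

theorem cyclicIndex_natCast (k : Fin v) : cyclicIndex v (k : ℕ) = k := by
  rw [← Fin.val_inj, ← Nat.cast_inj (R := ℤ), cyclicIndex_val]
  exact Int.emod_eq_of_lt (by positivity) (by exact_mod_cast k.2)

theorem cyclicIndex_add_one (m : ℤ) : cyclicIndex v (m + 1) = cyclicIndex v m + 1 := by
  rw [← Fin.val_inj, ← Nat.cast_inj (R := ℤ), cyclicIndex_val, Fin.val_add, Fin.val_one']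
  push_cast
  rw [cyclicIndex_val]
  simp

end cyclicIndex

namespace IsC2Boundary

variable {C : Set Plane} {v : ℕ} [NeZero v] {e : Fin v → ℝ → Plane}

/-- The closed curve composed of consecutive arcs. -/
noncomputable def closedCurve (e : Fin v → ℝ → Plane) (t : ℝ) : Plane :=
  e (cyclicIndex v ⌊t⌋) (Int.fract t)

/-- The formula of arc `m` persists at its right end, where the floor has already jumped, because
consecutive arcs join there. -/
theorem closedCurve_eq (h : IsC2Boundary C e) (m : ℤ) {t : ℝ} (ht : t ∈ Icc (m : ℝ) (m + 1)) :
    closedCurve e t = e (cyclicIndex v m) (t - m) := by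
  rcases eq_or_lt_of_le ht.2 with rfl | hlt
  · have h1 : ((m : ℝ) + 1) = ((m + 1 : ℤ) : ℝ) := by push_cast; ring
    rw [closedCurve, h1, Int.floor_intCast, Int.fract_intCast, cyclicIndex_add_one,
      ← h.consecutive]
    congr 1
    push_cast
    ring
  · have : ⌊t⌋ = m := Int.floor_eq_iff.2 ⟨ht.1, hlt⟩
    rw [closedCurve, Int.fract, this]

theorem hasDerivWithinAt_Icc (h : IsC2Boundary C e) (m : ℤ) {t : ℝ}
    (ht : t ∈ Icc (m : ℝ) (m + 1)) : HasDerivWithinAt (closedCurve e)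
      (derivWithin (e (cyclicIndex v m)) (Icc 0 1) (t - m)) (Icc (m : ℝ) (m + 1)) t := by
  have h1 := (h.arc (cyclicIndex v m)).hasDerivWithinAt (s := t - m)
    ⟨by linarith [ht.1], by linarith [ht.2]⟩
  have hmaps : MapsTo (fun x : ℝ => x - m) (Icc (m : ℝ) (m + 1)) (Icc 0 1) := fun x hx =>
    ⟨by linarith [hx.1], by linarith [hx.2]⟩
  have h2 := h1.scomp t ((hasDerivAt_id' t).sub_const (m : ℝ)).hasDerivWithinAt hmaps
  rw [one_smul] at h2
  exact h2.congr (fun x hx => h.closedCurve_eq m hx) (h.closedCurve_eq m ht)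

theorem hasDerivWithinAt_Ici (h : IsC2Boundary C e) (m : ℤ) {t : ℝ}
    (ht : t ∈ Ico (m : ℝ) (m + 1)) : HasDerivWithinAt (closedCurve e)
      (derivWithin (e (cyclicIndex v m)) (Icc 0 1) (t - m)) (Ici t) t :=
  (h.hasDerivWithinAt_Icc m ⟨ht.1, ht.2.le⟩).mono_of_mem_nhdsWithin (Icc_mem_nhdsGE_of_mem ht)

theorem hasDerivWithinAt_Iic (h : IsC2Boundary C e) (m : ℤ) {t : ℝ}
    (ht : t ∈ Ioc (m : ℝ) (m + 1)) : HasDerivWithinAt (closedCurve e)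
      (derivWithin (e (cyclicIndex v m)) (Icc 0 1) (t - m)) (Iic t) t :=
  (h.hasDerivWithinAt_Icc m ⟨ht.1.le, ht.2⟩).mono_of_mem_nhdsWithin (Icc_mem_nhdsLE_of_mem ht)

theorem exists_mem_Ico (t : ℝ) : ∃ m : ℤ, t ∈ Ico (m : ℝ) (m + 1) :=
  ⟨⌊t⌋, Int.floor_le t, Int.lt_floor_add_one t⟩

theorem exists_mem_Ioc (t : ℝ) : ∃ m : ℤ, t ∈ Ioc (m : ℝ) (m + 1) :=
  ⟨⌈t⌉ - 1, by push_cast; linarith [Int.ceil_lt_add_one t], by push_cast; linarith [Int.le_ceil t]⟩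

theorem continuous_closedCurve (h : IsC2Boundary C e) : Continuous (closedCurve e) := by
  refine continuous_iff_continuousAt.2 fun t => continuousAt_iff_continuous_left_right.2 ⟨?_, ?_⟩
  · obtain ⟨m, hm⟩ := exists_mem_Ioc t
    exact (h.hasDerivWithinAt_Iic m hm).continuousWithinAt
  · obtain ⟨m, hm⟩ := exists_mem_Ico t
    exact (h.hasDerivWithinAt_Ici m hm).continuousWithinAt

theorem isLoopParam (h : IsC2Boundary C e) :
    IsLoopParam (frontier C) (fun t => closedCurve e (v * t)) where
  continuous := h.continuous_closedCurve.comp (by fun_prop)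
  eq_iff s t := by
    have hv : (0 : ℝ) < v := by exact_mod_cast Nat.pos_of_ne_zero (NeZero.ne v)
    constructor
    · intro heq
      obtain ⟨h1, h2⟩ := h.simple _ _ _ ⟨Int.fract_nonneg _, Int.fract_lt_one _⟩ _
        ⟨Int.fract_nonneg _, Int.fract_lt_one _⟩ heq
      obtain ⟨q, hq⟩ := (cyclicIndex_eq_iff _ _).1 h1
      refine ⟨q, ?_⟩
      have hs := Int.floor_add_fract (v * s)
      have ht := Int.floor_add_fract (v * t)
      rw [hq, ← h2] at ht
      push_cast at ht
      refine mul_left_cancel₀ hv.ne' ?_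
      linarith
    · rintro ⟨q, rfl⟩
      have : (v : ℝ) * (s + q) = v * s + ((v * q : ℤ) : ℝ) := by push_cast; ring
      simp only [closedCurve, this, Int.floor_add_intCast, Int.fract_add_intCast]
      rw [(cyclicIndex_eq_iff _ _).2 ⟨q, rfl⟩]
  range_eq := by
    have hv : (0 : ℝ) < v := by exact_mod_cast Nat.pos_of_ne_zero (NeZero.ne v)
    rw [← h.image]
    apply Subset.antisymm
    · rintro _ ⟨t, rfl⟩
      exact mem_iUnion.2 ⟨_, _, ⟨Int.fract_nonneg _, (Int.fract_lt_one _).le⟩, rfl⟩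
    · intro x hx
      obtain ⟨k, s, hs, rfl⟩ := mem_iUnion.1 hx
      refine ⟨((k : ℕ) + s) / v, ?_⟩
      simp only [mul_div_cancel₀ _ hv.ne']
      rw [h.closedCurve_eq (k : ℕ) ⟨by simpa using hs.1, by simpa using hs.2⟩,
        cyclicIndex_natCast]
      simp

theorem strictMonoOn_right (h : IsC2Boundary C e) (m : ℤ) {t : ℝ} (ht : t ∈ Ico (m : ℝ) (m + 1))
    {u : Plane} (hu : 0 < ⟪u, derivWithin (e (cyclicIndex v m)) (Icc 0 1) (t - m)⟫) :
    ∃ ε > 0, StrictMonoOn (fun t => ⟪u, closedCurve e t⟫) (Icc t (t + ε)) := by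
  obtain ⟨δ, hδ, hmono⟩ := (h.arc _).exists_strictMonoOn ⟨by linarith [ht.1], by linarith [ht.2]⟩ hu
  have key : ∀ x ∈ Icc t (t + min δ (m + 1 - t)), x ∈ Icc (m : ℝ) (m + 1) ∧
      x - m ∈ Icc 0 1 ∩ Icc (t - m - δ) (t - m + δ) := by
    intro x hx
    have := min_le_left δ (m + 1 - t)
    have := min_le_right δ (m + 1 - t)
    exact ⟨⟨by linarith [hx.1, ht.1], by linarith [hx.2]⟩, ⟨by linarith [hx.1, ht.1],
      by linarith [hx.2]⟩, by linarith [hx.1], by linarith [hx.2]⟩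
  refine ⟨min δ (m + 1 - t), lt_min hδ (by linarith [ht.2]), fun x hx y hy hxy => ?_⟩
  simp only [h.closedCurve_eq m (key x hx).1, h.closedCurve_eq m (key y hy).1]
  exact hmono (key x hx).2 (key y hy).2 (by linarith)

theorem strictMonoOn_left (h : IsC2Boundary C e) (m : ℤ) {t : ℝ} (ht : t ∈ Ioc (m : ℝ) (m + 1))
    {u : Plane} (hu : 0 < ⟪u, derivWithin (e (cyclicIndex v m)) (Icc 0 1) (t - m)⟫) :
    ∃ ε > 0, StrictMonoOn (fun t => ⟪u, closedCurve e t⟫) (Icc (t - ε) t) := by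
  obtain ⟨δ, hδ, hmono⟩ := (h.arc _).exists_strictMonoOn ⟨by linarith [ht.1], by linarith [ht.2]⟩ hu
  have key : ∀ x ∈ Icc (t - min δ (t - m)) t, x ∈ Icc (m : ℝ) (m + 1) ∧
      x - m ∈ Icc 0 1 ∩ Icc (t - m - δ) (t - m + δ) := by
    intro x hx
    have := min_le_left δ (t - m)
    have := min_le_right δ (t - m)
    exact ⟨⟨by linarith [hx.1, ht.1], by linarith [hx.2, ht.2]⟩, ⟨by linarith [hx.1, ht.1],
      by linarith [hx.2, ht.2]⟩, by linarith [hx.1], by linarith [hx.2]⟩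
  refine ⟨min δ (t - m), lt_min hδ (by linarith [ht.1]), fun x hx y hy hxy => ?_⟩
  simp only [h.closedCurve_eq m (key x hx).1, h.closedCurve_eq m (key y hy).1]
  exact hmono (key x hx).2 (key y hy).2 (by linarith)

/-- The curve is regular inside the arcs and at degenerate vertices. -/
theorem exists_isRegularAt (h : IsC2Boundary C e) {t : ℝ}
    (ht : ∀ m : ℤ, t = m + 1 → IsDegeneratePair e (cyclicIndex v m)) :
    ∃ τ n, IsRegularAt (closedCurve e) t τ n := by
  obtain ⟨m, hm⟩ := exists_mem_Ico t
  set d := derivWithin (e (cyclicIndex v m)) (Icc 0 1) (t - m) with hd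
  have hd0 : d ≠ 0 := (h.arc _).velocity_ne_zero _ ⟨by linarith [hm.1], by linarith [hm.2]⟩
  have hdd : 0 < ⟪d, d⟫ := real_inner_self_pos.2 hd0
  obtain ⟨m', hm', r, hr, hd'⟩ : ∃ m' : ℤ, t ∈ Ioc (m' : ℝ) (m' + 1) ∧ ∃ r : ℝ, 0 < r ∧
      derivWithin (e (cyclicIndex v m')) (Icc 0 1) (t - m') = r • d := by
    rcases eq_or_lt_of_le hm.1 with heq | hlt
    · have ht1 : t = (m - 1 : ℤ) + 1 := by push_cast; linarith
      have hdeg := ht (m - 1) ht1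
      rw [IsDegeneratePair, ← cyclicIndex_add_one, sub_add_cancel] at hdeg
      rw [InnerProductGeometry.angle_comm, InnerProductGeometry.angle_eq_pi_iff] at hdeg
      -- Here `r < 0`, and `endHalfTangent` is the reversed velocity; the incoming velocity is
      -- therefore the positive multiple `-r` of the outgoing one.
      obtain ⟨-, r, hr, hrd⟩ := hdeg
      refine ⟨m - 1, ⟨?_, ht1.le⟩, -r, by linarith, ?_⟩
      · push_cast
        linarith
      · have e1 : t - ((m - 1 : ℤ) : ℝ) = 1 := by rw [ht1]; ring
        have e2 : t - m = 0 := by linarith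
        rw [hd, e1, e2]
        rw [endHalfTangent, startHalfTangent] at hrd
        rw [neg_smul, ← hrd, neg_neg]
    · exact ⟨m, ⟨hlt, hm.2.le⟩, 1, one_pos, by rw [one_smul]⟩
  refine isRegularAt_of_hasDerivWithinAt hd0 hr (h.hasDerivWithinAt_Ici m hm)
    (hd' ▸ h.hasDerivWithinAt_Iic m' hm') (h.strictMonoOn_right m hm hdd)
    (h.strictMonoOn_left m' hm' ?_)
  rw [hd', inner_smul_right]
  positivity

/-- If there is at most one corner, then the boundary is a tangent graph near all other points. -/
theorem exists_corner (h : IsC2Boundary C e) (hdeg : cornerDegree e ≤ 1) :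
    ∃ c ∈ frontier C, ∀ p ∈ frontier C, p ≠ c → ∃ τ n, IsGraphAt (frontier C) p τ n := by
  obtain ⟨k, hk⟩ : ∃ k : Fin v, ∀ l, l ≠ k → IsDegeneratePair e l := by
    by_cases hne : ∃ k, ¬ IsDegeneratePair e k
    · obtain ⟨k, hk⟩ := hne
      refine ⟨k, fun l hl => ?_⟩
      by_contra hl'
      exact hl ((Set.ncard_le_one (toFinite _)).1 hdeg l hl' k hk)
    · push Not at hne
      -- With no corner at all, the end of arc `0` takes its role.
      exact ⟨0, fun l _ => hne l⟩
  have hv : (0 : ℝ) < v := by exact_mod_cast Nat.pos_of_ne_zero (NeZero.ne v)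
  refine ⟨e k 1, h.image ▸ mem_iUnion.2 ⟨k, 1, by simp, rfl⟩, fun p hp hpc => ?_⟩
  rw [← h.isLoopParam.range_eq] at hp
  obtain ⟨t, rfl⟩ := hp
  obtain ⟨τ, n, hreg⟩ := h.exists_isRegularAt (t := v * t) fun m hm => hk _ fun hmk => hpc (by
    simp only
    rw [h.closedCurve_eq m ⟨by linarith, hm.le⟩, hmk, hm]
    congr 1
    ring)
  exact ⟨τ, n, (hreg.comp_mul hv).isGraphAt h.isLoopParam⟩

end IsC2Boundary

/-! ### One-corner tilings: local structure and nodes -/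

/-- A normal tiling by cells that are bounded by simple loops and have at most one corner `c i`. -/
structure IsOneCornerTiling {ι : Type*} (T : ι → Set Plane) (c : ι → Plane) : Prop where
  cover : ⋃ i, T i = univ
  nonoverlapping : ∀ i j, i ≠ j → Disjoint (interior (T i)) (interior (T j))
  isClosed : ∀ i, IsClosed (T i)
  subset_closure : ∀ i, T i ⊆ closure (interior (T i))
  inter_connected : ∀ i j, i ≠ j → IsPreconnected (T i ∩ T j)
  loop : ∀ i, IsSimpleLoop (frontier (T i))
  corner_mem : ∀ i, c i ∈ frontier (T i)
  halfplane : ∀ i, ∀ p ∈ frontier (T i), p ≠ c i → HasInnerHalfplane (T i) p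
  bounded : ∃ r D : ℝ, 0 < r ∧ 0 < D ∧
    ∀ i, (∃ b, Metric.ball b r ⊆ T i) ∧ ∀ x ∈ T i, ∀ y ∈ T i, dist x y ≤ D

theorem HasInnerHalfplane.exists_unit {K : Set Plane} {p : Plane} (h : HasInnerHalfplane K p) :
    ∃ n : Plane, ‖n‖ = 1 ∧ ∀ u : Plane, 0 < ⟪n, u⟫ → ∀ᶠ t : ℝ in 𝓝[>] 0, p + t • u ∈ interior K := by
  obtain ⟨n, hn, hu⟩ := h
  have hn' : 0 < ‖n‖ := norm_pos_iff.2 hn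
  refine ⟨‖n‖⁻¹ • n, by rw [norm_smul, norm_inv, norm_norm, inv_mul_cancel₀ hn'.ne'],
    fun u h => hu u ?_⟩
  rw [real_inner_smul_left] at h
  exact (pos_iff_pos_of_mul_pos h).1 (by positivity)

/-- Three sets with disjoint interiors cannot all contain a half-plane of directions. -/
theorem not_three_hasInnerHalfplane {K₁ K₂ K₃ : Set Plane} {p : Plane}
    (h₁₂ : Disjoint (interior K₁) (interior K₂)) (h₁₃ : Disjoint (interior K₁) (interior K₃))
    (h₂₃ : Disjoint (interior K₂) (interior K₃)) (h₁ : HasInnerHalfplane K₁ p)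
    (h₂ : HasInnerHalfplane K₂ p) (h₃ : HasInnerHalfplane K₃ p) : False := by
  obtain ⟨a, ha, hau⟩ := h₁.exists_unit
  obtain ⟨b, hb, hbu⟩ := h₂.exists_unit
  obtain ⟨d, hd, hdu⟩ := h₃.exists_unit
  have key : ∀ {K K' : Set Plane} {m n : Plane}, Disjoint (interior K) (interior K') → ‖m‖ = 1 →
      ‖n‖ = 1 → (∀ u : Plane, 0 < ⟪m, u⟫ → ∀ᶠ t : ℝ in 𝓝[>] 0, p + t • u ∈ interior K) →
      (∀ u : Plane, 0 < ⟪n, u⟫ → ∀ᶠ t : ℝ in 𝓝[>] 0, p + t • u ∈ interior K') →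
      1 + ⟪m, n⟫ ≤ 0 := by
    -- Unless `m` and `n` are opposite, the direction `m + n` lies in both half-planes.
    intro K K' m n hd hm hn hmu hnu
    by_contra! hpos
    obtain ⟨t, ht1, ht2⟩ := ((hmu (m + n) (by
      rw [inner_add_right, real_inner_self_eq_norm_sq, hm]; linarith)).and (hnu (m + n) (by
      rw [inner_add_right, real_inner_self_eq_norm_sq, hn, real_inner_comm]; linarith))).exists
    exact disjoint_left.1 hd ht1 ht2
  have e1 := key h₁₂ ha hb hau hbu
  have e2 := key h₁₃ ha hd hau hdu
  have e3 := key h₂₃ hb hd hbu hdu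
  -- The three inequalities would give `‖a + b + d‖ ^ 2 ≤ 3 - 6`.
  have h1 := norm_add_sq_real (a + b) d
  rw [norm_add_sq_real a b, inner_add_left, ha, hb, hd] at h1
  nlinarith [sq_nonneg ‖a + b + d‖]

namespace IsOneCornerTiling

variable {ι : Type*} {T : ι → Set Plane} {c : ι → Plane}

/-- The number of cells that meet a disk is bounded by the quotient of areas. -/
theorem exists_card_bound (h : IsOneCornerTiling T c) : ∃ M D : ℝ, 0 < M ∧ 0 < D ∧
    (∀ i, ∀ x ∈ T i, ∀ y ∈ T i, dist x y ≤ D) ∧ ∀ (x : Plane) (ρ : ℝ), 0 ≤ ρ → ∀ s : Finset ι,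
      (∀ i ∈ s, (T i ∩ Metric.closedBall x ρ).Nonempty) → (s.card : ℝ) ≤ M * (ρ + D) ^ 2 := by
  obtain ⟨r, D, hr, hD, hT⟩ := h.bounded
  refine ⟨(r ^ 2)⁻¹, D, by positivity, hD, fun i => (hT i).2, fun x ρ hρ s hs => ?_⟩
  choose b hb using fun i => (hT i).1
  have hint : ∀ i, Metric.ball (b i) r ⊆ interior (T i) := fun i =>
    interior_maximal (hb i) Metric.isOpen_ball
  have hdisj : (s : Set ι).PairwiseDisjoint fun i => Metric.ball (b i) r := fun i _ j _ hij =>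
    (h.nonoverlapping i j hij).mono (hint i) (hint j)
  have hsub : ⋃ i ∈ s, Metric.ball (b i) r ⊆ Metric.closedBall x (ρ + D) := by
    refine iUnion₂_subset fun i hi y hy => ?_
    obtain ⟨z, hz, hzx⟩ := hs i hi
    have h1 := (hT i).2 y (hb i hy) z hz
    rw [Metric.mem_closedBall] at hzx ⊢
    linarith [dist_triangle y z x]
  have hmeas := MeasureTheory.measure_mono (μ := MeasureTheory.volume) hsub
  rw [MeasureTheory.measure_biUnion_finset hdisj fun i _ => Metric.isOpen_ball.measurableSet] at hmeas
  simp only [MeasureTheory.Measure.addHaar_ball_of_pos _ _ hr,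
    MeasureTheory.Measure.addHaar_closedBall _ _ (show 0 ≤ ρ + D by linarith), Finset.sum_const,
    nsmul_eq_mul] at hmeas
  have hpos : MeasureTheory.volume (Metric.ball (0 : Plane) 1) ≠ 0 :=
    (Metric.measure_ball_pos _ _ one_pos).ne'
  have hfin : MeasureTheory.volume (Metric.ball (0 : Plane) 1) ≠ ⊤ :=
    MeasureTheory.measure_ball_lt_top.ne
  rw [← mul_assoc, ENNReal.mul_le_mul_iff_left hpos hfin, ← ENNReal.ofReal_natCast,
    ← ENNReal.ofReal_mul (by positivity), ENNReal.ofReal_le_ofReal_iff (by positivity)] at hmeas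
  simp only [finrank_euclideanSpace, Fintype.card_fin] at hmeas
  rw [inv_mul_eq_div, le_div_iff₀ (by positivity)]
  exact hmeas

theorem finite_meeting_closedBall (h : IsOneCornerTiling T c) (x : Plane) (ρ : ℝ) :
    {i | (T i ∩ Metric.closedBall x ρ).Nonempty}.Finite := by
  obtain ⟨M, D, -, -, -, hM⟩ := h.exists_card_bound
  have key : {i | (T i ∩ Metric.closedBall x (max ρ 0)).Nonempty}.Finite := by
    by_contra hinf
    obtain ⟨n, hn⟩ := exists_nat_gt (M * (max ρ 0 + D) ^ 2)
    obtain ⟨s, hs, hcard⟩ := Set.Infinite.exists_subset_card_eq hinf n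
    have := hM x (max ρ 0) (le_max_right _ _) s fun i hi => hs hi
    rw [hcard] at this
    linarith
  refine key.subset fun i hi => hi.mono ?_
  exact inter_subset_inter_right _ (Metric.closedBall_subset_closedBall (le_max_left _ _))

theorem finite_meeting (h : IsOneCornerTiling T c) (i : ι) : {j | (T j ∩ T i).Nonempty}.Finite := by
  obtain ⟨r, D, -, -, hT⟩ := h.bounded
  have hci := (h.isClosed i).frontier_subset (h.corner_mem i)
  refine (h.finite_meeting_closedBall (c i) D).subset fun j hj => hj.mono ?_
  exact inter_subset_inter_right _ fun x hx => (hT i).2 x hx _ hci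

theorem isBounded (h : IsOneCornerTiling T c) (i : ι) : Bornology.IsBounded (T i) := by
  obtain ⟨r, D, -, -, hT⟩ := h.bounded
  exact Metric.isBounded_iff.2 ⟨D, fun x hx y hy => (hT i).2 x hx y hy⟩

theorem interior_nonempty (h : IsOneCornerTiling T c) (i : ι) : (interior (T i)).Nonempty := by
  obtain ⟨r, D, hr, -, hT⟩ := h.bounded
  obtain ⟨b, hb⟩ := (hT i).1
  exact ⟨b, interior_maximal hb Metric.isOpen_ball (Metric.mem_ball_self hr)⟩

theorem locallyFinite (h : IsOneCornerTiling T c) : LocallyFinite T := fun x =>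
  ⟨_, Metric.closedBall_mem_nhds x one_pos, h.finite_meeting_closedBall x 1⟩

theorem isClosed_biUnion (h : IsOneCornerTiling T c) (A : Set ι) : IsClosed (⋃ i ∈ A, T i) := by
  rw [biUnion_eq_iUnion]
  exact (h.locallyFinite.comp_injective Subtype.val_injective).isClosed_iUnion
    fun i => h.isClosed i

theorem exists_mem (h : IsOneCornerTiling T c) (p : Plane) : ∃ i, p ∈ T i :=
  mem_iUnion.1 (h.cover ▸ mem_univ p)

theorem frontier_subset (h : IsOneCornerTiling T c) (i : ι) : frontier (T i) ⊆ T i :=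
  (h.isClosed i).frontier_subset

/-- Each cell is the closure of its interior, so a point of `T j` interior to `T i` would make the
two interiors overlap. -/
theorem inter_subset_frontier (h : IsOneCornerTiling T c) {i j : ι} (hij : i ≠ j) :
    T i ∩ T j ⊆ frontier (T i) := by
  rintro p ⟨hpi, hpj⟩
  refine ⟨_root_.subset_closure hpi, fun hint => ?_⟩
  obtain ⟨x, hx1, hx2⟩ := mem_closure_iff.1 (h.subset_closure j hpj) _ isOpen_interior hint
  exact disjoint_left.1 (h.nonoverlapping i j hij) hx1 hx2

theorem mem_frontier (h : IsOneCornerTiling T c) {i j : ι} (hij : i ≠ j) {p : Plane}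
    (hi : p ∈ T i) (hj : p ∈ T j) : p ∈ frontier (T i) := h.inter_subset_frontier hij ⟨hi, hj⟩

/-- By local finiteness the union of the other cells is closed. If it missed `p`, a whole
neighborhood of `p` would belong to `T i`. -/
theorem exists_ne_mem (h : IsOneCornerTiling T c) {i : ι} {p : Plane} (hp : p ∈ frontier (T i)) :
    ∃ j, j ≠ i ∧ p ∈ T j := by
  by_contra! hcon
  have hopen : IsOpen (⋃ j ∈ {j | j ≠ i}, T j)ᶜ := (h.isClosed_biUnion _).isOpen_compl
  refine hp.2 (mem_interior.2 ⟨_, fun x hx => ?_, hopen, fun hx => ?_⟩)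
  · obtain ⟨j, hj⟩ := h.exists_mem x
    by_cases hji : j = i
    · exact hji ▸ hj
    · exact absurd (mem_biUnion (show j ∈ {j | j ≠ i} from hji) hj) hx
  · simp only [mem_iUnion] at hx
    obtain ⟨j, hj, hpj⟩ := hx
    exact hcon j hj hpj

/-- At most two cells that meet at a point do not have their corner there. -/
theorem eq_corner_of_three (h : IsOneCornerTiling T c) {i j k : ι} (hij : i ≠ j) (hik : i ≠ k)
    (hjk : j ≠ k) {p : Plane} (hi : p ∈ T i) (hj : p ∈ T j) (hk : p ∈ T k) :
    p = c i ∨ p = c j ∨ p = c k := by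
  by_contra! hcon
  exact not_three_hasInnerHalfplane (h.nonoverlapping i j hij) (h.nonoverlapping i k hik)
    (h.nonoverlapping j k hjk) (h.halfplane i p (h.mem_frontier hij hi hj) hcon.1)
    (h.halfplane j p (h.mem_frontier hij.symm hj hi) hcon.2.1)
    (h.halfplane k p (h.mem_frontier hik.symm hk hi) hcon.2.2)

theorem mem_range_of_three (h : IsOneCornerTiling T c) {i j k : ι} (hij : i ≠ j) (hik : i ≠ k)
    (hjk : j ≠ k) {p : Plane} (hi : p ∈ T i) (hj : p ∈ T j) (hk : p ∈ T k) : p ∈ range c := by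
  rcases h.eq_corner_of_three hij hik hjk hi hj hk with rfl | rfl | rfl <;> exact mem_range_self _

theorem finite_nodes (h : IsOneCornerTiling T c) (i : ι) : (range c ∩ T i).Finite := by
  refine ((h.finite_meeting i).image c).subset ?_
  rintro _ ⟨⟨j, rfl⟩, hj⟩
  exact ⟨j, ⟨c j, h.frontier_subset j (h.corner_mem j), hj⟩, rfl⟩

/-- A connected part of the boundary of a cell without nodes belongs to a single other cell. -/
theorem exists_neighbor (h : IsOneCornerTiling T c) {i : ι} {S : Set Plane}
    (hS : IsPreconnected S) (hne : S.Nonempty) (hSi : S ⊆ frontier (T i))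
    (hnode : Disjoint S (range c)) : ∃ j, j ≠ i ∧ S ⊆ T j := by
  obtain ⟨p, hp⟩ := hne
  obtain ⟨j, hji, hpj⟩ := h.exists_ne_mem (hSi hp)
  refine ⟨j, hji, ?_⟩
  -- Two closed sets cover the connected set `S`. A point of `S` in both would lie in three cells,
  -- hence be a node.
  have hcov : S ⊆ T j ∪ ⋃ k ∈ {k | k ≠ i ∧ k ≠ j}, T k := by
    intro x hx
    obtain ⟨k, hki, hxk⟩ := h.exists_ne_mem (hSi hx)
    by_cases hkj : k = j
    · exact Or.inl (hkj ▸ hxk)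
    · exact Or.inr (mem_biUnion (show k ∈ {k | k ≠ i ∧ k ≠ j} from ⟨hki, hkj⟩) hxk)
  intro x hx
  refine (hcov hx).elim id fun hx' => ?_
  obtain ⟨y, hy, hyj, hy'⟩ := isPreconnected_closed_iff.1 hS _ _ (h.isClosed j)
    (h.isClosed_biUnion _) hcov ⟨p, hp, hpj⟩ ⟨x, hx, hx'⟩
  simp only [mem_iUnion] at hy'
  obtain ⟨k, ⟨hki, hkj⟩, hyk⟩ := hy'
  exact absurd (h.mem_range_of_three hji.symm (Ne.symm hki) (Ne.symm hkj)
    (h.frontier_subset i (hSi hy)) hyj hyk) (disjoint_left.1 hnode hy)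

/-- No finite nonempty family of cells is closed under adjacency. -/
theorem not_closed_family (h : IsOneCornerTiling T c) (F : Finset ι) (hF : F.Nonempty)
    (hadj : ∀ i ∈ F, ∀ p ∈ frontier (T i), p ∉ range c → ∃ j ∈ F, j ≠ i ∧ p ∈ T j) : False := by
  set K := ⋃ i ∈ F, T i with hK
  have hKcl : IsClosed K := h.isClosed_biUnion (F : Set ι)
  have hbdd : Bornology.IsBounded K :=
    (Bornology.isBounded_biUnion_finset F).2 fun i _ => h.isBounded i
  obtain ⟨i₀, hi₀⟩ := hF
  have hint : (interior K).Nonempty :=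
    (h.interior_nonempty i₀).mono (interior_mono (subset_biUnion_of_mem (u := T) hi₀))
  refine infinite_frontier_of_isBounded hbdd hint
    ((F.finite_toSet.biUnion fun i _ => h.finite_nodes i).subset fun p hp => ?_)
  have hpK := hKcl.frontier_subset hp
  simp only [hK, mem_iUnion] at hpK
  obtain ⟨i, hi, hpi⟩ := hpK
  refine mem_biUnion hi ⟨?_, hpi⟩
  by_contra hnode
  have hpf : p ∈ frontier (T i) := by
    refine ⟨_root_.subset_closure hpi, fun hpint => hp.2 ?_⟩
    exact interior_mono (subset_biUnion_of_mem (u := T) hi) hpint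
  obtain ⟨j, hj, hji, hpj⟩ := hadj i hi p hpf hnode
  -- As `p` is not a node, `i` and `j` are the only cells there. Cells outside `F` stay away from
  -- `p`, so `p` is interior to `K`.
  refine hp.2 (mem_interior.2 ⟨_, fun x hx => ?_,
    (h.isClosed_biUnion {k | k ∉ F}).isOpen_compl, fun hx => ?_⟩)
  · obtain ⟨k, hk⟩ := h.exists_mem x
    by_cases hkF : k ∈ F
    · exact mem_biUnion hkF hk
    · exact absurd (mem_biUnion (show k ∈ {k | k ∉ F} from hkF) hk) hx
  · simp only [mem_iUnion] at hx
    obtain ⟨k, hkF, hpk⟩ := hx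
    refine hnode (h.mem_range_of_three hji.symm ?_ ?_ hpi hpj hpk)
    · rintro rfl; exact hkF hi
    · rintro rfl; exact hkF hj

/-! ### Neighbors and nodes of a single cell -/

/-- If two cells meet a third one and each other in two common points, then they enclose it. -/
theorem frontier_subset_of_two_common (h : IsOneCornerTiling T c) {i j k : ι} (hij : i ≠ j)
    (hik : i ≠ k) (hjk : j ≠ k) {p q : Plane} (hpq : p ≠ q) (hpi : p ∈ T i) (hpj : p ∈ T j)
    (hpk : p ∈ T k) (hqi : q ∈ T i) (hqj : q ∈ T j) (hqk : q ∈ T k) :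
    frontier (T j) ⊆ T i ∪ T k := by
  -- Both contacts of `T j` are connected and contain `p` and `q`. Triple points are nodes, hence
  -- finite in number, so the contacts contain complementary arcs.
  have := (h.loop j).subset_union_of_finite_inter hpq (S₁ := T j ∩ T i) (S₂ := T j ∩ T k)
    (h.inter_subset_frontier hij.symm) (h.inter_subset_frontier hjk)
    (h.inter_connected j i hij.symm) (h.inter_connected j k hjk) ⟨hpj, hpi⟩ ⟨hqj, hqi⟩ ⟨hpj, hpk⟩
    ⟨hqj, hqk⟩ ((h.finite_nodes i).subset fun x hx =>
      ⟨h.mem_range_of_three hij hik hjk hx.1.2 hx.1.1 hx.2.2, hx.1.2⟩)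
  exact this.trans (union_subset_union inter_subset_right inter_subset_right)

theorem not_frontier_subset_one (h : IsOneCornerTiling T c) {i j : ι} (hij : i ≠ j) :
    ¬ frontier (T i) ⊆ T j := by
  classical
  intro hsub
  have hsub' : frontier (T i) ⊆ frontier (T j) := fun p hp =>
    h.mem_frontier hij.symm (hsub hp) (h.frontier_subset i hp)
  have heq := (h.loop i).eq_of_subset (h.loop j) hsub'
  refine h.not_closed_family {i, j} ⟨i, by simp⟩ ?_
  intro k hk p hp _
  rcases Finset.mem_insert.1 hk with rfl | hk
  · exact ⟨j, by simp, hij.symm, hsub hp⟩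
  · rw [Finset.mem_singleton] at hk
    subst hk
    exact ⟨i, by simp, hij, h.frontier_subset i (heq ▸ hp)⟩

/-- A cell has at least three neighbors. -/
theorem not_frontier_subset_two (h : IsOneCornerTiling T c) {i j k : ι} (hij : i ≠ j)
    (hik : i ≠ k) : ¬ frontier (T i) ⊆ T j ∪ T k := by
  classical
  intro hsub
  have hj := h.not_frontier_subset_one hij
  have hk := h.not_frontier_subset_one hik
  have hjk : j ≠ k := by
    rintro rfl
    exact hj (by simpa using hsub)
  -- Neither neighbor suffices alone, so all three cells share two points, and each is then enclosed
  -- by the other two.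
  obtain ⟨p, ⟨hp, hpj, hpk⟩, q, ⟨hq, hqj, hqk⟩, hpq⟩ :=
    (h.loop i).exists_two_mem_inter (h.isClosed j) (h.isClosed k) hsub hj hk
  have hpi := h.frontier_subset i hp
  have hqi := h.frontier_subset i hq
  have h1 := h.frontier_subset_of_two_common hij hik hjk hpq hpi hpj hpk hqi hqj hqk
  have h2 := h.frontier_subset_of_two_common hik hij hjk.symm hpq hpi hpk hpj hqi hqk hqj
  refine h.not_closed_family {i, j, k} ⟨i, by simp⟩ ?_
  intro l hl x hx _
  simp only [Finset.mem_insert, Finset.mem_singleton] at hl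
  rcases hl with rfl | rfl | rfl
  · rcases hsub hx with hx | hx
    · exact ⟨j, by simp, hij.symm, hx⟩
    · exact ⟨k, by simp, hik.symm, hx⟩
  · rcases h1 hx with hx | hx
    · exact ⟨i, by simp, hij, hx⟩
    · exact ⟨k, by simp, hjk.symm, hx⟩
  · rcases h2 hx with hx | hx
    · exact ⟨i, by simp, hik, hx⟩
    · exact ⟨j, by simp, hjk, hx⟩

/-- The nodes on the boundary of a cell: the points where some cell has its corner. -/
def nodes (T : ι → Set Plane) (c : ι → Plane) (i : ι) : Set Plane := range c ∩ T i

theorem nodes_subset_frontier (h : IsOneCornerTiling T c) (i : ι) :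
    nodes T c i ⊆ frontier (T i) := by
  rintro _ ⟨⟨j, rfl⟩, hj⟩
  by_cases hij : i = j
  · exact hij ▸ h.corner_mem i
  · exact h.mem_frontier hij hj (h.frontier_subset j (h.corner_mem j))

/-- An arc of the boundary of a cell without nodes belongs to a single other cell. -/
theorem exists_neighbor_arc (h : IsOneCornerTiling T c) {i : ι} {γ : ℝ → Plane}
    (hγ : IsLoopParam (frontier (T i)) γ) {a b : ℝ} (hab : a < b)
    (hnode : ∀ t ∈ Ioo a b, γ t ∉ nodes T c i) : ∃ j, j ≠ i ∧ γ '' Icc a b ⊆ T j := by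
  obtain ⟨j, hj, hsub⟩ := h.exists_neighbor (hγ.isPreconnected_image_Ioo a b)
    ((nonempty_Ioo.2 hab).image _) (by rintro _ ⟨t, -, rfl⟩; exact hγ.mem t) (by
      rw [disjoint_left]
      rintro _ ⟨t, ht, rfl⟩ hr
      exact hnode t ht ⟨hr, h.frontier_subset i (hγ.mem t)⟩)
  exact ⟨j, hj, hγ.image_Icc_subset_of_isClosed hab (h.isClosed j) hsub⟩

theorem image_Icc_union {γ : ℝ → Plane} {a b d : ℝ} (hab : a ≤ b) (hbd : b ≤ d) :
    γ '' Icc a d = γ '' Icc a b ∪ γ '' Icc b d := by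
  rw [← image_union, Icc_union_Icc_eq_Icc hab hbd]

/-- The boundary of a cell contains at least three nodes. -/
theorem three_le_ncard_nodes (h : IsOneCornerTiling T c) (i : ι) : 3 ≤ (nodes T c i).ncard := by
  by_contra! hlt
  obtain ⟨p, hp, q, hq, hpq, hsub⟩ : ∃ p ∈ frontier (T i), ∃ q ∈ frontier (T i), p ≠ q ∧
      nodes T c i ⊆ {p, q} := by
    have hc : c i ∈ nodes T c i := ⟨mem_range_self i, h.frontier_subset i (h.corner_mem i)⟩
    by_cases hne : ∃ q ∈ nodes T c i, q ≠ c i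
    · obtain ⟨q, hq, hqc⟩ := hne
      refine ⟨c i, h.corner_mem i, q, h.nodes_subset_frontier i hq, hqc.symm, ?_⟩
      have hpair : ({c i, q} : Set Plane).ncard = 2 := Set.ncard_pair hqc.symm
      refine (Set.eq_of_subset_of_ncard_le (s := {c i, q}) (t := nodes T c i) ?_ ?_
        (h.finite_nodes i)).ge
      · exact insert_subset hc (singleton_subset_iff.2 hq)
      · omega
    · push Not at hne
      -- A lone node is supplemented by an arbitrary point, so that there are two arcs in any case.
      obtain ⟨q, hq, hqc⟩ := (h.loop i).exists_ne (c i)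
      exact ⟨c i, h.corner_mem i, q, hq, hqc.symm, fun x hx => Or.inl (hne x hx)⟩
  obtain ⟨γ, hγ, rfl, s, hs, rfl⟩ := (h.loop i).exists_param₂ hp hq hpq
  have hnode : ∀ t ∈ Ioo (0 : ℝ) 1, t ≠ s → γ t ∉ nodes T c i := by
    intro t ht hts hn
    rcases hsub hn with h0 | h0
    · exact ht.1.ne' (hγ.injOn (a := 0) ⟨ht.1.le, by linarith [ht.2]⟩ (by simp) h0)
    · exact hts (hγ.injOn (a := 0) ⟨ht.1.le, by linarith [ht.2]⟩ ⟨hs.1.le, by linarith [hs.2]⟩ h0)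
  obtain ⟨j, hj, hj'⟩ := h.exists_neighbor_arc hγ hs.1 fun t ht =>
    hnode t ⟨ht.1, ht.2.trans hs.2⟩ ht.2.ne
  obtain ⟨k, hk, hk'⟩ := h.exists_neighbor_arc hγ hs.2 fun t ht =>
    hnode t ⟨hs.1.trans ht.1, ht.2⟩ ht.1.ne'
  refine h.not_frontier_subset_two hj.symm hk.symm ?_
  rw [← hγ.image_Icc, image_Icc_union hs.1.le hs.2.le]
  exact union_subset_union hj' hk'

/-- If a neighbor `j` of `i` has only three nodes, and shares with `i` a node with `l` only and a
node with `k` only, then `i`, `k` and `l` enclose `j`. -/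
theorem frontier_subset_three (h : IsOneCornerTiling T c) {i j k l : ι} (hij : i ≠ j)
    {p q : Plane} (hpq : p ≠ q) (hp : p ∈ nodes T c i) (hq : q ∈ nodes T c i) (hpj : p ∈ T j)
    (hqj : q ∈ T j) (hpc : ∀ m, p ∈ T m → m = i ∨ m = j ∨ m = k)
    (hqc : ∀ m, q ∈ T m → m = i ∨ m = j ∨ m = l) (hcard : (nodes T c j).ncard ≤ 3) :
    frontier (T j) ⊆ T i ∪ (T k ∪ T l) := by
  -- One arc between `p` and `q` is shared with `T i`. The other has at most one node inside, so
  -- each of its pieces ends at `p` or `q`, where the possible neighbors are known.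
  obtain ⟨γ, hγ, rfl, s, hs, rfl, harc⟩ := (h.loop j).exists_param_arc_subset hpq
    (h.inter_subset_frontier hij.symm) (h.inter_connected j i hij.symm) ⟨hpj, hp.2⟩ ⟨hqj, hq.2⟩
  have hfirst : ∀ {b : ℝ}, 0 < b → (∀ t ∈ Ioo 0 b, γ t ∉ nodes T c j) →
      γ '' Icc 0 b ⊆ T i ∪ (T k ∪ T l) := by
    intro b hb hn
    obtain ⟨m, hm, hsub⟩ := h.exists_neighbor_arc hγ hb hn
    rcases hpc m (hsub ⟨0, ⟨le_rfl, hb.le⟩, rfl⟩) with rfl | rfl | rfl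
    · exact hsub.trans subset_union_left
    · exact absurd rfl hm
    · exact hsub.trans (subset_union_left.trans subset_union_right)
  have hlast : ∀ {b : ℝ}, b < s → (∀ t ∈ Ioo b s, γ t ∉ nodes T c j) →
      γ '' Icc b s ⊆ T i ∪ (T k ∪ T l) := by
    intro b hb hn
    obtain ⟨m, hm, hsub⟩ := h.exists_neighbor_arc hγ hb hn
    rcases hqc m (hsub ⟨s, ⟨hb.le, le_rfl⟩, rfl⟩) with rfl | rfl | rfl
    · exact hsub.trans subset_union_left
    · exact absurd rfl hm
    · exact hsub.trans (subset_union_right.trans subset_union_right)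
  rw [← hγ.image_Icc, image_Icc_union hs.1.le hs.2.le]
  refine union_subset ?_ (harc.trans (inter_subset_right.trans subset_union_left))
  by_cases hn : ∃ t ∈ Ioo 0 s, γ t ∈ nodes T c j
  · obtain ⟨t, ht, htn⟩ := hn
    have hinj : ∀ {x y : ℝ}, x ∈ Icc 0 s → y ∈ Icc 0 s → γ x = γ y → x = y := fun hx hy =>
      hγ.injOn (a := 0) ⟨hx.1, by linarith [hx.2, hs.2]⟩ ⟨hy.1, by linarith [hy.2, hs.2]⟩
    have hI0 : (0 : ℝ) ∈ Icc 0 s := ⟨le_rfl, hs.1.le⟩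
    have hIs : s ∈ Icc 0 s := ⟨hs.1.le, le_rfl⟩
    have hIt : t ∈ Icc 0 s := ⟨ht.1.le, ht.2.le⟩
    have hall : nodes T c j ⊆ {γ 0, γ s, γ t} := by
      have h3 : ({γ 0, γ s, γ t} : Set Plane).ncard = 3 := by
        refine Set.ncard_eq_three.2 ⟨_, _, _, hpq, fun h0 => ?_, fun h0 => ?_, rfl⟩
        · exact ht.1.ne (hinj hI0 hIt h0)
        · exact ht.2.ne' (hinj hIs hIt h0)
      refine (Set.eq_of_subset_of_ncard_le (t := nodes T c j) ?_ (by omega) (h.finite_nodes j)).ge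
      exact insert_subset ⟨hp.1, hpj⟩ (insert_subset ⟨hq.1, hqj⟩ (singleton_subset_iff.2 htn))
    have hnone : ∀ x ∈ Ioo 0 s, x ≠ t → γ x ∉ nodes T c j := by
      intro x hx hxt hxn
      have hIx : x ∈ Icc 0 s := ⟨hx.1.le, hx.2.le⟩
      rcases hall hxn with h0 | h0 | h0
      · exact hx.1.ne' (hinj hIx hI0 h0)
      · exact hx.2.ne (hinj hIx hIs h0)
      · exact hxt (hinj hIx hIt h0)
    rw [image_Icc_union ht.1.le ht.2.le]
    refine union_subset (hfirst ht.1 fun x hx => hnone x ⟨hx.1, hx.2.trans ht.2⟩ hx.2.ne)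
      (hlast ht.2 fun x hx => hnone x ⟨ht.1.trans hx.1, hx.2⟩ hx.1.ne')
  · push Not at hn
    exact hfirst hs.1 hn

/-- A cell with exactly three nodes, all of degree three, has a neighbor with more than three
nodes: otherwise the cell and its neighbors would form a tetrahedron. -/
theorem exists_four_le (h : IsOneCornerTiling T c) (i : ι) :
    (∃ j, (T j ∩ T i).Nonempty ∧ 4 ≤ (nodes T c j).ncard) ∨
    ∃ p ∈ nodes T c i, ∀ j k, ∃ m, p ∈ T m ∧ m ≠ i ∧ m ≠ j ∧ m ≠ k := by
  classical
  by_contra! hcon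
  obtain ⟨hcard, hdeg⟩ := hcon
  have hcard' : ∀ j, (T j ∩ T i).Nonempty → (nodes T c j).ncard ≤ 3 := fun j hj => by
    have := hcard j hj
    omega
  have hTi : (T i ∩ T i).Nonempty := by
    rw [inter_self]
    exact ⟨c i, h.frontier_subset i (h.corner_mem i)⟩
  obtain ⟨p, q, x, hpq, hpx, hqx, hnodes⟩ := Set.ncard_eq_three.1
    ((hcard' i hTi).antisymm (h.three_le_ncard_nodes i))
  have hp : p ∈ nodes T c i := hnodes ▸ by simp
  have hq : q ∈ nodes T c i := hnodes ▸ by simp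
  have hx : x ∈ nodes T c i := hnodes ▸ by simp
  obtain ⟨γ, hγ, rfl⟩ := (h.loop i).exists_param (h.nodes_subset_frontier i hp)
  have hparam : ∀ y ∈ nodes T c i, γ 0 ≠ y → ∃ s ∈ Ioo (0 : ℝ) 1, γ s = y := by
    intro y hy hne
    have : y ∈ frontier (T i) \ {γ 0} := ⟨h.nodes_subset_frontier i hy, hne.symm⟩
    rw [hγ.diff_singleton] at this
    exact this
  obtain ⟨s, hs, t, ht, hst, hnodes⟩ : ∃ s ∈ Ioo (0 : ℝ) 1, ∃ t ∈ Ioo (0 : ℝ) 1, s < t ∧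
      nodes T c i = {γ 0, γ s, γ t} := by
    obtain ⟨s, hs, rfl⟩ := hparam q hq hpq
    obtain ⟨t, ht, rfl⟩ := hparam x hx hpx
    rcases lt_trichotomy s t with hst | rfl | hst
    · exact ⟨s, hs, t, ht, hst, hnodes⟩
    · exact absurd rfl hqx
    · exact ⟨t, ht, s, hs, hst, by rw [hnodes, pair_comm]⟩
  clear hpq hpx hqx hq hx
  have hinj : ∀ {x y : ℝ}, x ∈ Ico (0 : ℝ) 1 → y ∈ Ico (0 : ℝ) 1 → γ x = γ y → x = y := fun hx hy =>
    hγ.injOn (a := 0) ⟨hx.1, by linarith [hx.2]⟩ ⟨hy.1, by linarith [hy.2]⟩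
  have hI0 : (0 : ℝ) ∈ Ico (0 : ℝ) 1 := by simp
  have hIs : s ∈ Ico (0 : ℝ) 1 := ⟨hs.1.le, hs.2⟩
  have hIt : t ∈ Ico (0 : ℝ) 1 := ⟨ht.1.le, ht.2⟩
  have hp : γ 0 ∈ nodes T c i := hnodes ▸ by simp
  have hq : γ s ∈ nodes T c i := hnodes ▸ by simp
  have hx : γ t ∈ nodes T c i := hnodes ▸ by simp
  have hpq : γ 0 ≠ γ s := fun h0 => hs.1.ne (hinj hI0 hIs h0)
  have hpx : γ 0 ≠ γ t := fun h0 => ht.1.ne (hinj hI0 hIt h0)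
  have hqx : γ s ≠ γ t := fun h0 => hst.ne (hinj hIs hIt h0)
  have hnone : ∀ y ∈ Ioo (0 : ℝ) 1, y ≠ s → y ≠ t → γ y ∉ nodes T c i := by
    intro y hy hys hyt hyn
    have hIy : y ∈ Ico (0 : ℝ) 1 := ⟨hy.1.le, hy.2⟩
    rw [hnodes] at hyn
    rcases hyn with h0 | h0 | h0
    · exact hy.1.ne' (hinj hIy hI0 h0)
    · exact hys (hinj hIy hIs h0)
    · exact hyt (hinj hIy hIt h0)
  -- The three nodes cut the boundary into arcs with neighbors `A`, `B`, `C`; each node lies on the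
  -- two neighbors whose arcs end there.
  obtain ⟨A, hA, hA'⟩ := h.exists_neighbor_arc hγ hs.1 fun y hy =>
    hnone y ⟨hy.1, hy.2.trans hs.2⟩ hy.2.ne (hy.2.trans hst).ne
  obtain ⟨B, hB, hB'⟩ := h.exists_neighbor_arc hγ hst fun y hy =>
    hnone y ⟨hs.1.trans hy.1, hy.2.trans ht.2⟩ hy.1.ne' hy.2.ne
  obtain ⟨C, hC, hC'⟩ := h.exists_neighbor_arc hγ ht.2 fun y hy =>
    hnone y ⟨ht.1.trans hy.1, hy.2⟩ (hst.trans hy.1).ne' hy.1.ne'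
  have hcov : frontier (T i) ⊆ T A ∪ (T B ∪ T C) := by
    rw [← hγ.image_Icc, image_Icc_union hs.1.le hs.2.le, image_Icc_union hst.le ht.2.le]
    exact union_subset_union hA' (union_subset_union hB' hC')
  have hAB : A ≠ B := by
    rintro rfl
    exact h.not_frontier_subset_two hA.symm hC.symm (by rwa [← union_assoc, union_self] at hcov)
  have hBC : B ≠ C := by
    rintro rfl
    exact h.not_frontier_subset_two hA.symm hB.symm (by rwa [union_self] at hcov)
  have hAC : A ≠ C := by
    rintro rfl
    exact h.not_frontier_subset_two hB.symm hA.symm (hcov.trans (by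
      rintro y (hy | hy | hy)
      exacts [Or.inr hy, Or.inl hy, Or.inr hy]))
  have hpA : γ 0 ∈ T A := hA' ⟨0, ⟨le_rfl, hs.1.le⟩, rfl⟩
  have hqA : γ s ∈ T A := hA' ⟨s, ⟨hs.1.le, le_rfl⟩, rfl⟩
  have hqB : γ s ∈ T B := hB' ⟨s, ⟨le_rfl, hst.le⟩, rfl⟩
  have hxB : γ t ∈ T B := hB' ⟨t, ⟨hst.le, le_rfl⟩, rfl⟩
  have hxC : γ t ∈ T C := hC' ⟨t, ⟨le_rfl, ht.2.le⟩, rfl⟩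
  have hpC : γ 0 ∈ T C := hC' ⟨1, ⟨ht.2.le, le_rfl⟩, hγ.eq_one_zero⟩
  -- By `hdeg` at most two cells other than `i` contain a given node, so two known ones exhaust
  -- them.
  have hcells : ∀ {y : Plane} {j k : ι}, y ∈ nodes T c i → y ∈ T j → y ∈ T k → j ≠ i → k ≠ i →
      j ≠ k → ∀ m, y ∈ T m → m = i ∨ m = j ∨ m = k := by
    intro y j k hy hyj hyk hji hki hjk m hym
    obtain ⟨j', k', hall⟩ := hdeg y hy
    have h1 := hall j hyj hji
    have h2 := hall k hyk hki
    by_cases hmi : m = i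
    · exact Or.inl hmi
    have h3 := hall m hym hmi
    clear * - h1 h2 h3 hjk
    by_cases hj : j = j' <;> by_cases hk : k = j' <;> by_cases hm : m = j' <;> grind
  have hA3 := h.frontier_subset_three hA.symm hpq hp hq hpA hqA
    (hcells hp hpA hpC hA hC hAC) (hcells hq hqA hqB hA hB hAB) (hcard' A ⟨_, hpA, hp.2⟩)
  have hB3 := h.frontier_subset_three hB.symm hqx hq hx hqB hxB
    (hcells hq hqB hqA hB hA hAB.symm) (hcells hx hxB hxC hB hC hBC) (hcard' B ⟨_, hqB, hq.2⟩)
  have hC3 := h.frontier_subset_three hC.symm hpx hp hx hpC hxC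
    (hcells hp hpC hpA hC hA hAC.symm) (hcells hx hxC hxB hC hB hBC.symm)
    (hcard' C ⟨_, hpC, hp.2⟩)
  refine h.not_closed_family {i, A, B, C} ⟨i, by simp⟩ ?_
  intro l hl y hy _
  simp only [Finset.mem_insert, Finset.mem_singleton] at hl
  have key : ∀ {j k m : ι}, j ≠ l → k ≠ l → m ≠ l → y ∈ T j ∪ (T k ∪ T m) →
      (j ∈ ({i, A, B, C} : Finset ι)) → (k ∈ ({i, A, B, C} : Finset ι)) →
      (m ∈ ({i, A, B, C} : Finset ι)) → ∃ j ∈ ({i, A, B, C} : Finset ι), j ≠ l ∧ y ∈ T j := by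
    rintro j k m hj hk hm (hy | hy | hy) h1 h2 h3
    exacts [⟨j, h1, hj, hy⟩, ⟨k, h2, hk, hy⟩, ⟨m, h3, hm, hy⟩]
  rcases hl with rfl | rfl | rfl | rfl
  · exact key hA hB hC (hcov hy) (by simp) (by simp) (by simp)
  · exact key hA.symm hAC.symm hAB.symm (hA3 hy) (by simp) (by simp) (by simp)
  · exact key hB.symm hAB hBC.symm (hB3 hy) (by simp) (by simp) (by simp)
  · exact key hC.symm hAC hBC (hC3 hy) (by simp) (by simp) (by simp)

end IsOneCornerTiling

/-! ### Counting nodes and exponential growth -/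

namespace IsOneCornerTiling

variable {ι : Type*} {T : ι → Set Plane} {c : ι → Plane}

/-- The cells that meet the disk of radius `R` around the origin. -/
noncomputable def cellsWithin (h : IsOneCornerTiling T c) (R : ℝ) : Finset ι :=
  (h.finite_meeting_closedBall 0 R).toFinset

theorem mem_cellsWithin (h : IsOneCornerTiling T c) {R : ℝ} {i : ι} :
    i ∈ h.cellsWithin R ↔ ∃ x ∈ T i, ‖x‖ ≤ R := by
  simp [cellsWithin, Set.Nonempty]

/-- Some other cell has its corner where the cell `i` has its own. -/
def SharesCorner (c : ι → Plane) (i : ι) : Prop := ∃ j, j ≠ i ∧ c j = c i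

theorem norm_le_of_mem (h : IsOneCornerTiling T c) {D : ℝ}
    (hD : ∀ i, ∀ x ∈ T i, ∀ y ∈ T i, dist x y ≤ D) {R : ℝ} {i : ι} (hi : i ∈ h.cellsWithin R)
    {y : Plane} (hy : y ∈ T i) : ‖y‖ ≤ R + D := by
  obtain ⟨x, hx, hxR⟩ := h.mem_cellsWithin.1 hi
  have h1 := hD i y hy x hx
  rw [dist_eq_norm] at h1
  have h2 := norm_add_le (y - x) x
  rw [sub_add_cancel] at h2
  linarith

/-- Near every cell there is one with more than three nodes or with a shared corner. -/
theorem exists_excess (h : IsOneCornerTiling T c) (i : ι) :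
    ∃ j, (T j ∩ T i).Nonempty ∧ (4 ≤ (nodes T c j).ncard ∨ SharesCorner c j) := by
  rcases h.exists_four_le i with ⟨j, hj, h4⟩ | ⟨p, ⟨⟨j, rfl⟩, hpi⟩, hp⟩
  · exact ⟨j, hj, Or.inl h4⟩
  have hpj := h.frontier_subset j (h.corner_mem j)
  refine ⟨j, ⟨c j, hpj, hpi⟩, Or.inr ?_⟩
  -- At least four cells contain `c j`. Among three of them other than `j`, one must have its corner
  -- there too.
  obtain ⟨m₁, h1, h1i, h1j, -⟩ := hp j j
  obtain ⟨m₂, h2, h2i, h2j, h21⟩ := hp j m₁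
  by_cases hij : i = j
  · obtain ⟨m₃, h3, h3i, h31, h32⟩ := hp m₁ m₂
    rcases h.eq_corner_of_three h21.symm h31.symm h32.symm h1 h2 h3 with h0 | h0 | h0
    exacts [⟨m₁, h1j, h0.symm⟩, ⟨m₂, h2j, h0.symm⟩, ⟨m₃, hij ▸ h3i, h0.symm⟩]
  · rcases h.eq_corner_of_three h1i.symm h2i.symm h21.symm hpi h1 h2 with h0 | h0 | h0
    exacts [⟨i, hij, h0.symm⟩, ⟨m₁, h1j, h0.symm⟩, ⟨m₂, h2j, h0.symm⟩]

open Classical in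
/-- At every node at most two cells do not have their corner. -/
theorem sum_ncard_nodes_le (h : IsOneCornerTiling T c) {D : ℝ}
    (hD : ∀ i, ∀ x ∈ T i, ∀ y ∈ T i, dist x y ≤ D) (R : ℝ) :
    ∑ i ∈ h.cellsWithin R, ((nodes T c i).ncard - 1) ≤
      ∑ j ∈ h.cellsWithin (R + D), (2 - if SharesCorner c j then 1 else 0) := by
  set S := h.cellsWithin R
  set S' := h.cellsWithin (R + D)
  -- The norm bound guarantees that every cell with its corner at a point of `V` belongs to `S'`.
  set V : Finset Plane := (S'.image c).filter fun p => ‖p‖ ≤ R + D with hV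
  have hcm : ∀ j, c j ∈ T j := fun j => h.frontier_subset j (h.corner_mem j)
  have hQ : ∀ i ∈ S, (nodes T c i).ncard - 1 = (V.filter fun p => p ∈ T i ∧ p ≠ c i).card := by
    intro i hi
    rw [← Set.ncard_sdiff_singleton_of_mem (show c i ∈ nodes T c i from ⟨mem_range_self i, hcm i⟩),
      ← Set.ncard_coe_finset]
    congr 1
    ext p
    simp only [hV, Finset.coe_filter, Finset.mem_filter, Finset.mem_image, mem_ofPred_eq]
    constructor
    · rintro ⟨⟨⟨j, rfl⟩, hj⟩, hne⟩
      have hn := h.norm_le_of_mem hD hi hj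
      exact ⟨⟨⟨j, h.mem_cellsWithin.2 ⟨c j, hcm j, hn⟩, rfl⟩, hn⟩, hj, hne⟩
    · rintro ⟨⟨⟨j, -, rfl⟩, -⟩, hj, hne⟩
      exact ⟨⟨mem_range_self j, hj⟩, hne⟩
  rw [Finset.sum_congr rfl hQ]
  have hswap := Finset.sum_card_bipartiteAbove_eq_sum_card_bipartiteBelow (s := S) (t := V)
    (fun i p => p ∈ T i ∧ p ≠ c i)
  simp only [Finset.bipartiteAbove, Finset.bipartiteBelow] at hswap
  rw [hswap]
  calc ∑ p ∈ V, (S.filter fun i => p ∈ T i ∧ p ≠ c i).card ≤ ∑ p ∈ V, 2 := by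
        refine Finset.sum_le_sum fun p _ => ?_
        by_contra! hlt
        obtain ⟨i, j, k, hi, hj, hk, hij, hik, hjk⟩ := Finset.two_lt_card_iff.1 hlt
        simp only [Finset.mem_filter] at hi hj hk
        rcases h.eq_corner_of_three hij hik hjk hi.2.1 hj.2.1 hk.2.1 with h0 | h0 | h0
        exacts [hi.2.2 h0, hj.2.2 h0, hk.2.2 h0]
    _ ≤ ∑ p ∈ V, ∑ j ∈ S' with c j = p, (2 - if SharesCorner c j then 1 else 0) := by
        refine Finset.sum_le_sum fun p hp => ?_
        simp only [hV, Finset.mem_filter, Finset.mem_image] at hp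
        obtain ⟨⟨j, hj, rfl⟩, hn⟩ := hp
        -- The two units at a node are charged to two cells with weight 1 if the corner is shared,
        -- and to one cell with weight 2 otherwise.
        by_cases hs : SharesCorner c j
        · obtain ⟨k, hkj, hk⟩ := hs
          have hk' : k ∈ S' := h.mem_cellsWithin.2 ⟨c k, hcm k, hk ▸ hn⟩
          calc 2 = ∑ l ∈ ({j, k} : Finset ι), 1 := by simp [Finset.card_pair hkj.symm]
            _ ≤ ∑ l ∈ ({j, k} : Finset ι), (2 - if SharesCorner c l then 1 else 0) := by
                refine Finset.sum_le_sum fun l _ => ?_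
                split_ifs <;> omega
            _ ≤ _ := by
                refine Finset.sum_le_sum_of_subset fun l hl => ?_
                simp only [Finset.mem_insert, Finset.mem_singleton] at hl
                rcases hl with rfl | rfl <;> simp [*]
        · have : (2 - if SharesCorner c j then 1 else 0) = 2 := by simp [hs]
          nth_rw 1 [← this]
          exact Finset.single_le_sum (f := fun j => 2 - if SharesCorner c j then 1 else 0)
            (fun _ _ => Nat.zero_le _) (by simp [hj])
    _ ≤ ∑ p ∈ S'.image c, ∑ j ∈ S' with c j = p, (2 - if SharesCorner c j then 1 else 0) :=
        Finset.sum_le_sum_of_subset (Finset.filter_subset _ _)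
    _ = _ := Finset.sum_fiberwise_of_maps_to (fun j hj => Finset.mem_image_of_mem c hj) _

open Classical in
/-- The cells with more than three nodes or a shared corner force the tiling to grow. -/
theorem two_mul_card_add_le (h : IsOneCornerTiling T c) {D : ℝ} (hD0 : 0 ≤ D)
    (hD : ∀ i, ∀ x ∈ T i, ∀ y ∈ T i, dist x y ≤ D) (R : ℝ) :
    2 * (h.cellsWithin R).card + ((h.cellsWithin R).filter fun i =>
      4 ≤ (nodes T c i).ncard ∨ SharesCorner c i).card ≤ 2 * (h.cellsWithin (R + D)).card := by
  have hsum := h.sum_ncard_nodes_le hD R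
  set S := h.cellsWithin R
  set S' := h.cellsWithin (R + D)
  have hSS' : S ⊆ S' := fun i hi => by
    obtain ⟨x, hx, hxR⟩ := h.mem_cellsWithin.1 hi
    exact h.mem_cellsWithin.2 ⟨x, hx, by linarith⟩
  have h1 : ∑ i ∈ S, (2 + if 4 ≤ (nodes T c i).ncard then 1 else 0) ≤
      ∑ i ∈ S, ((nodes T c i).ncard - 1) := by
    refine Finset.sum_le_sum fun i _ => ?_
    have := h.three_le_ncard_nodes i
    split_ifs <;> omega
  have h2 : ∑ j ∈ S', (2 - if SharesCorner c j then 1 else 0) +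
      ∑ j ∈ S', (if SharesCorner c j then 1 else 0) = 2 * S'.card := by
    rw [← Finset.sum_add_distrib, mul_comm, ← smul_eq_mul, ← Finset.sum_const]
    refine Finset.sum_congr rfl fun j _ => ?_
    split_ifs <;> omega
  have h3 : (S.filter fun i => 4 ≤ (nodes T c i).ncard ∨ SharesCorner c i).card ≤
      ∑ i ∈ S, (if 4 ≤ (nodes T c i).ncard then 1 else 0) +
      ∑ i ∈ S, (if SharesCorner c i then 1 else 0) := by
    rw [Finset.card_filter, ← Finset.sum_add_distrib]
    refine Finset.sum_le_sum fun i _ => ?_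
    by_cases hA : 4 ≤ (nodes T c i).ncard <;> by_cases hB : SharesCorner c i <;> simp [hA, hB]
  have h4 : ∑ i ∈ S, (if SharesCorner c i then 1 else 0) ≤
      ∑ i ∈ S', (if SharesCorner c i then 1 else 0) := Finset.sum_le_sum_of_subset hSS'
  rw [Finset.sum_add_distrib, Finset.sum_const, smul_eq_mul] at h1
  omega

/-- Such a tiling grows exponentially, but the area of a disk does not. -/
theorem not_isOneCornerTiling : ¬ IsOneCornerTiling T c := by
  classical
  intro h
  obtain ⟨M, D, hM, hD0, hD, hcard⟩ := h.exists_card_bound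
  choose f hf hexc using h.exists_excess
  have hcm : ∀ j, c j ∈ T j := fun j => h.frontier_subset j (h.corner_mem j)
  -- The disk of radius `D` around `c j` contains `T j`, so `n` bounds the number of cells meeting
  -- `T j` and thus the fibers of `f`.
  obtain ⟨n, hn⟩ := exists_nat_gt (M * (D + D) ^ 2)
  have hn0 : (0 : ℝ) < n := lt_of_le_of_lt (by positivity) hn
  have hbad : ∀ R, (h.cellsWithin R).card ≤ n * ((h.cellsWithin (R + D)).filter fun i =>
      4 ≤ (nodes T c i).ncard ∨ SharesCorner c i).card := by
    intro R
    refine Finset.card_le_mul_card_image_of_maps_to (f := f) (fun i hi => ?_) n fun j _ => ?_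
    · obtain ⟨x, hxf, hxi⟩ := hf i
      exact Finset.mem_filter.2 ⟨h.mem_cellsWithin.2 ⟨x, hxf, h.norm_le_of_mem hD hi hxi⟩, hexc i⟩
    · have := hcard (c j) D hD0.le ((h.cellsWithin R).filter fun i => f i = j) fun i hi => by
        obtain ⟨x, hxf, hxi⟩ := hf i
        rw [(Finset.mem_filter.1 hi).2] at hxf
        exact ⟨x, hxi, hD j x hxf _ (hcm j)⟩
      exact_mod_cast this.trans hn.le
  -- One step of `D` reaches the excess cells, at least a fraction `1 / n` of the original count.
  -- Another step turns the excess into growth by the factor `1 + 1 / (2 * n)`.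
  have hgrow : ∀ R, (2 * n + 1 : ℝ) / (2 * n) * (h.cellsWithin R).card ≤
      (h.cellsWithin (R + D + D)).card := by
    intro R
    have h1 := h.two_mul_card_add_le hD0.le hD (R + D)
    have h2 := hbad R
    have hmono : (h.cellsWithin R).card ≤ (h.cellsWithin (R + D)).card :=
      Finset.card_le_card fun i hi => by
        obtain ⟨x, hx, hxR⟩ := h.mem_cellsWithin.1 hi
        exact h.mem_cellsWithin.2 ⟨x, hx, by linarith⟩
    have h3 : n * (2 * (h.cellsWithin R).card) + (h.cellsWithin R).card ≤
        n * (2 * (h.cellsWithin (R + D + D)).card) := by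
      refine le_trans ?_ (Nat.mul_le_mul_left n h1)
      rw [mul_add]
      exact add_le_add (Nat.mul_le_mul_left n (Nat.mul_le_mul_left 2 hmono)) h2
    have h3' : (n : ℝ) * (2 * (h.cellsWithin R).card) + (h.cellsWithin R).card ≤
        n * (2 * (h.cellsWithin (R + D + D)).card) := by exact_mod_cast h3
    rw [div_mul_eq_mul_div, div_le_iff₀ (by positivity)]
    linarith
  set r : ℝ := (2 * n + 1 : ℝ) / (2 * n) with hr
  have hr1 : 1 < r := by
    rw [hr, lt_div_iff₀ (by positivity)]
    linarith
  have hpow : ∀ k : ℕ, r ^ k ≤ (h.cellsWithin (2 * D * k)).card := by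
    intro k
    induction k with
    | zero =>
      obtain ⟨i, hi⟩ := h.exists_mem 0
      have : 0 < (h.cellsWithin (2 * D * (0 : ℕ))).card :=
        Finset.card_pos.2 ⟨i, h.mem_cellsWithin.2 ⟨0, hi, by simp⟩⟩
      simpa using this
    | succ k ih =>
      have h1 := hgrow (2 * D * k)
      have e1 : 2 * D * (k : ℝ) + D + D = 2 * D * ((k + 1 : ℕ) : ℝ) := by push_cast; ring
      rw [e1] at h1
      rw [pow_succ']
      exact (mul_le_mul_of_nonneg_left ih (by positivity)).trans h1
  have hlim := (tendsto_pow_const_div_const_pow_of_one_lt 2 hr1).const_mul (M * (3 * D) ^ 2)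
  rw [mul_zero] at hlim
  obtain ⟨k, hk, hk1⟩ := ((hlim.eventually (gt_mem_nhds one_pos)).and (eventually_ge_atTop 1)).exists
  have hk1' : (1 : ℝ) ≤ k := by exact_mod_cast hk1
  have h1 := hcard 0 (2 * D * k) (by positivity) (h.cellsWithin (2 * D * k)) fun i hi => by
    obtain ⟨x, hx, hxR⟩ := h.mem_cellsWithin.1 hi
    exact ⟨x, hx, by simpa using hxR⟩
  have h2 : M * (2 * D * k + D) ^ 2 ≤ M * (3 * D) ^ 2 * k ^ 2 := by
    rw [show M * (3 * D) ^ 2 * (k : ℝ) ^ 2 = M * (3 * D * k) ^ 2 by ring]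
    refine mul_le_mul_of_nonneg_left (pow_le_pow_left₀ (by positivity) ?_ 2) hM.le
    nlinarith
  have hrk : 0 < r ^ k := by positivity
  rw [← mul_div_assoc, div_lt_one hrk] at hk
  linarith [hpow k]

end IsOneCornerTiling

/-! ### Transport by congruence and conclusion -/

/-- An isometry of the plane is affine by Mazur–Ulam, and its linear part carries the half-plane of
directions along. -/
theorem HasInnerHalfplane.image {K : Set Plane} {p : Plane} (h : HasInnerHalfplane K p)
    (f : Plane ≃ᵢ Plane) : HasInnerHalfplane (f '' K) (f p) := by
  obtain ⟨n, hn, hu⟩ := h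
  set A := f.toRealAffineIsometryEquiv
  set L := A.linearIsometryEquiv
  refine ⟨L n, by simpa using hn, fun u hnu => ?_⟩
  have h1 : 0 < ⟪n, L.symm u⟫ := by
    rw [← L.inner_map_map, L.apply_symm_apply]
    exact hnu
  filter_upwards [hu _ h1] with t ht
  have h2 : f (p + t • L.symm u) = f p + t • u := by
    have := A.map_vadd p (t • L.symm u)
    rw [vadd_eq_add, vadd_eq_add, add_comm] at this
    rw [add_comm (f p)]
    refine Eq.trans this ?_
    rw [map_smul]
    change t • L (L.symm u) + _ = _
    rw [L.apply_symm_apply]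
    rfl
  have h3 := f.toHomeomorph.image_interior K
  change f '' interior K = interior (f '' K) at h3
  rw [← h3, ← h2]
  exact mem_image_of_mem f ht

/-- A normal monohedral tiling by cells with at most one corner is a one-corner tiling. -/
theorem IsNormalTiling.exists_isOneCornerTiling {ι : Type*} {T : ι → Set Plane}
    (hnormal : IsNormalTiling T) (hmono : IsMonohedral T) {i : ι} {v : ℕ} [NeZero v]
    {e : Fin v → ℝ → Plane} (he : IsC2Boundary (T i) e) (hdeg : cornerDegree e ≤ 1) :
    ∃ c, IsOneCornerTiling T c := by
  obtain ⟨r, R, hr, hbd⟩ := hnormal.uniformly_bounded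
  have hcpt : ∀ j, IsCompact (T j) := fun j => by
    obtain ⟨φ⟩ := hnormal.disk j
    have : CompactSpace (Metric.closedBall (0 : Plane) 1) :=
      isCompact_iff_compactSpace.1 (isCompact_closedBall _ _)
    exact isCompact_iff_compactSpace.2 φ.symm.compactSpace
  have hint : (interior (T i)).Nonempty := by
    obtain ⟨⟨b, hb⟩, -⟩ := hbd i
    exact ⟨b, interior_mono hb (Metric.ball_subset_interior_closedBall (Metric.mem_ball_self hr))⟩
  obtain ⟨c₀, hc₀, hgraph⟩ := he.exists_corner hdeg
  have hloop : IsSimpleLoop (frontier (T i)) := ⟨_, he.isLoopParam⟩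
  have hreg := subset_closure_interior_of_isGraphAt (hcpt i) hint hloop hc₀ hgraph
  have hhalf : ∀ p ∈ frontier (T i), p ≠ c₀ → HasInnerHalfplane (T i) p := fun p hp hpc => by
    obtain ⟨τ, n, hg⟩ := hgraph p hp hpc
    exact hg.hasInnerHalfplane (hreg ((hcpt i).isClosed.frontier_subset hp))
  choose f hf using hmono i
  have hfr : ∀ j, f j '' frontier (T i) = frontier (T j) := fun j => by
    rw [← hf j]
    exact (f j).toHomeomorph.image_frontier _
  have hinterior : ∀ j, f j '' interior (T i) = interior (T j) := fun j => by
    rw [← hf j]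
    exact (f j).toHomeomorph.image_interior _
  refine ⟨fun j => f j c₀, hnormal.cover, hnormal.nonoverlapping, fun j => (hcpt j).isClosed,
    fun j => ?_, hnormal.inter_connected, fun j => ?_, fun j => ?_, fun j p hp hpc => ?_,
    r, |2 * R| + 1, hr, by positivity, fun j => ?_⟩
  · rw [← hinterior, ← hf j]
    exact (image_mono hreg).trans (image_closure_subset_closure_image (f j).continuous)
  · rw [← hfr]
    exact hloop.image (f j).toHomeomorph
  · rw [← hfr]
    exact mem_image_of_mem _ hc₀
  · rw [← hfr] at hp
    obtain ⟨q, hq, rfl⟩ := hp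
    rw [← hf j]
    exact (hhalf q hq fun hqc => hpc (by rw [hqc])).image (f j)
  · obtain ⟨⟨b, hb⟩, a, ha⟩ := hbd j
    refine ⟨⟨b, Metric.ball_subset_closedBall.trans hb⟩, fun x hx y hy => ?_⟩
    have hx' := Metric.mem_closedBall.1 (ha hx)
    have hy' := Metric.mem_closedBall.1 (ha hy)
    linarith [dist_triangle_right x y a, le_abs_self (2 * R)]

theorem corollary1 {ι : Type*} (T : ι → Set Plane)
    (hnormal : IsNormalTiling T) (hmono : IsMonohedral T)
    (i : ι) (v : ℕ) [NeZero v] (e : Fin v → ℝ → Plane) (he : IsC2Boundary (T i) e) :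
    2 ≤ cornerDegree e := by
  by_contra! hlt
  obtain ⟨c, hc⟩ := hnormal.exists_isOneCornerTiling hmono he (by omega)
  exact IsOneCornerTiling.not_isOneCornerTiling hc
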